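/- Let $n\ge 1$. A \emph{positroid} on $[n]=\{1<\dots<n\}$ is a matroid on the ground set $[n]$ of the form $M(A)$, where, for some $d\ge 0$, $A$ is a real $d\times n$ matrix of rank $d$ all of whose maximal minors are nonnegative, and the bases of $M(A)$ are the sets $B\subseteq[n]$ such that the columns of $A$ indexed by $B$ form a linear basis of $\mathbb{R}^d$. A matroid is \emph{connected} if it is not the direct sum of two matroids with nonempty ground sets. Let $p(n)$ be the number of positroids on $[n]$, let $p_c(n)$ be the number of connected positroids on $[n]$, and put \[ P(x) = 1+\sum_{n\ge 1} p(n)x^n, \qquad P_c(x) = 1+\sum_{n\ge 1} p_c(n)x^n \] in $\mathbb{Q}[[x]]$. Then \[ xP(x) = \left(\frac{x}{P_c(x)}\right)^{\langle -1\rangle}, \] where $G(x)^{\langle -1\rangle}$ denotes the compositional inverse of a formal power series $G(x)$ with zero constant term and nonzero linear coefficient. -/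

import Mathlib

namespace PositroidEnum

/-- A real `d × n` matrix is totally nonnegative (in the sense used for positroids) if it has
rank `d` and all its maximal minors (columns taken in increasing order) are nonnegative. -/
def TotallyNonneg {d n : ℕ} (A : Matrix (Fin d) (Fin n) ℝ) : Prop :=
  A.rank = d ∧ ∀ f : Fin d ↪o Fin n, 0 ≤ (A.submatrix id f).det

/-- `M = M(A)`: the ground set of `M` is the whole set of column indices, and the bases of `M`
are exactly the sets of indices whose columns form a linear basis of `ℝ ^ d`. -/
def IsMatroidOf {d n : ℕ} (M : Matroid (Fin n)) (A : Matrix (Fin d) (Fin n) ℝ) : Prop :=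
  M.E = Set.univ ∧ ∀ B : Set (Fin n), M.IsBase B ↔
    LinearIndepOn ℝ A.col B ∧ Submodule.span ℝ (A.col '' B) = ⊤

/-- A positroid on the ordered ground set `Fin n`. -/
def IsPositroid {n : ℕ} (M : Matroid (Fin n)) : Prop :=
  ∃ (d : ℕ) (A : Matrix (Fin d) (Fin n) ℝ), TotallyNonneg A ∧ IsMatroidOf M A

/-- A matroid is connected if it is not the direct sum of two nonempty matroids. -/
def MatroidConnected {α : Type*} (M : Matroid α) : Prop :=
  ¬ ∃ (M₁ M₂ : Matroid α) (h : Disjoint M₁.E M₂.E),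
    M₁.E.Nonempty ∧ M₂.E.Nonempty ∧ M = M₁.disjointSum M₂ h

/-- The number of positroids on an `n`-element ordered set. -/
noncomputable def numPositroids (n : ℕ) : ℕ :=
  Nat.card {M : Matroid (Fin n) // IsPositroid M}

/-- The number of connected positroids on an `n`-element ordered set. -/
noncomputable def numConnectedPositroids (n : ℕ) : ℕ :=
  Nat.card {M : Matroid (Fin n) // IsPositroid M ∧ MatroidConnected M}

/-- `P(x) = 1 + ∑_{n ≥ 1} p(n) x^n`. -/
noncomputable def positroidSeries : PowerSeries ℚ :=
  PowerSeries.mk fun n => if n = 0 then 1 else (numPositroids n : ℚ)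

/-- `P_c(x) = 1 + ∑_{n ≥ 1} p_c(n) x^n`. -/
noncomputable def connectedPositroidSeries : PowerSeries ℚ :=
  PowerSeries.mk fun n => if n = 0 then 1 else (numConnectedPositroids n : ℚ)

theorem constantCoeff_connectedPositroidSeries :
    PowerSeries.constantCoeff connectedPositroidSeries = 1 := by
  simp [connectedPositroidSeries, ← PowerSeries.coeff_zero_eq_constantCoeff_apply]

/-- The power series `x / P_c(x)`. -/
noncomputable def xDivConnectedPositroidSeries : PowerSeries ℚ :=
  PowerSeries.X * connectedPositroidSeries⁻¹

/-- The linear coefficient of `x / P_c(x)` is a unit (so, the constant coefficient being zero,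
the compositional inverse exists). -/
theorem isUnit_coeff_one_xDivConnectedPositroidSeries :
    IsUnit (PowerSeries.coeff 1 xDivConnectedPositroidSeries) := by
  have h : PowerSeries.coeff 1 xDivConnectedPositroidSeries = 1 := by
    rw [xDivConnectedPositroidSeries, show (1 : ℕ) = 0 + 1 from rfl,
      PowerSeries.coeff_succ_X_mul]
    simp [constantCoeff_connectedPositroidSeries]
  rw [h]
  exact isUnit_one

end PositroidEnum

/-!
A positroid decomposes uniquely into connected positroids placed on the blocks of a noncrossing
partition of its ground set. Sorting positroids on `n ≥ 1` elements by the component `S` of the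
least element, the rest of the positroid is an arbitrary choice of a positroid on each of the gaps
between consecutive elements of `S` (the last gap running up to the end). A component with `k`
elements thus contributes `p_c(k)` times the coefficient of `x ^ n` in `(x P(x)) ^ k`, so that
`P(x) = P_c(x P(x))` (`positroidSeries_eq_subst`). This says that `x P(x)` is a right inverse of
`x / P_c(x)` for substitution, hence the inverse.

Matroids are considered on finite sets of natural numbers, where restriction and direct sum keep
the names of the elements. Multiplying a maximal minor by the Vandermonde determinant of its
columns (`normMinor`) makes it independent of the order in which the columns are listed, which
turns total nonnegativity into a condition on unsorted tuples (`IsPosRep`). Three facts about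
positroids carry the decomposition.

* Restrictions of positroids are positroids (`PosRep.restrict`).
* A positroid placed in a gap of another one gives a positroid, their direct sum
  (`PosRep.disjointSum`, `PosRep.disjointSum_gap`).
* Components do not cross. If circuits `C ∋ a, c` and `C' ∋ b, d` in different components crossed,
  there would be four bases `{a, b} ∪ J`, `{c, b} ∪ J`, `{a, d} ∪ J`, `{c, d} ∪ J` the product of
  whose minors is negative (`PosRep.not_crossing`). Applied to a circuit leaving a gap of a
  component and a circuit joining the two parts into which it cuts the component, this shows that
  the gaps are separators (`IsComp.isSep_gap`).
-/

namespace PositroidEnum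

open Matrix

/-! ### Vandermonde-normalized minors -/

/-- The Vandermonde determinant `∏ i < j, (g j - g i)` of a tuple of natural numbers. Its sign is
the sign of the permutation sorting `g`, and it vanishes when `g` is not injective. -/
noncomputable def vdm {d : ℕ} (g : Fin d → ℕ) : ℝ :=
  (vandermonde fun i => (g i : ℝ)).det

theorem vdm_eq_prod {d : ℕ} (g : Fin d → ℕ) :
    vdm g = ∏ i, ∏ j, if i < j then ((g j : ℝ) - g i) else 1 := by
  rw [vdm, det_vandermonde]
  refine Finset.prod_congr rfl fun i _ => ?_
  rw [← Finset.prod_filter]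
  refine Finset.prod_congr ?_ fun _ _ => rfl
  ext j; simp

theorem vdm_ne_zero {d : ℕ} {g : Fin d → ℕ} (hg : g.Injective) : vdm g ≠ 0 :=
  det_vandermonde_ne_zero_iff.2 fun _ _ h => hg (Nat.cast_injective h)

theorem vdm_pos {d : ℕ} {g : Fin d → ℕ} (hg : StrictMono g) : 0 < vdm g := by
  rw [vdm_eq_prod]
  refine Finset.prod_pos fun i _ => Finset.prod_pos fun j _ => ?_
  split_ifs with h
  · exact sub_pos.2 (Nat.cast_lt.2 (hg h))
  · exact one_pos

theorem vdm_append {r s : ℕ} (g : Fin r → ℕ) (h : Fin s → ℕ) :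
    vdm (Fin.append g h) = vdm g * vdm h * ∏ i, ∏ j, ((h j : ℝ) - g i) := by
  have e1 : ∀ (i : Fin r) (j : Fin s), Fin.castAdd s i < Fin.natAdd r j := by
    intro i j; rw [Fin.lt_def, Fin.val_castAdd, Fin.val_natAdd]; omega
  have e2 : ∀ (i : Fin r) (j : Fin s), ¬ Fin.natAdd r j < Fin.castAdd s i := by
    intro i j; rw [Fin.lt_def, Fin.val_castAdd, Fin.val_natAdd]; omega
  have e3 : ∀ i j : Fin r, Fin.castAdd s i < Fin.castAdd s j ↔ i < j := by
    intro i j; simp [Fin.lt_def, -Fin.val_fin_lt]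
  have e4 : ∀ i j : Fin s, Fin.natAdd r i < Fin.natAdd r j ↔ i < j := by
    intro i j; simp [Fin.lt_def, -Fin.val_fin_lt]
  simp only [vdm_eq_prod, Fin.prod_univ_add, Fin.append_left, Fin.append_right, e1, e2, e3, e4,
    if_true, if_false, Finset.prod_mul_distrib, Finset.prod_const_one]
  ring

/-- The maximal minor of the vector configuration `v` at the tuple `g`, multiplied by the
Vandermonde determinant of `g`. It does not depend on the order of `g`, and has the sign of the
minor with sorted columns. -/
noncomputable def normMinor {d : ℕ} (v : ℕ → Fin d → ℝ) (g : Fin d → ℕ) : ℝ :=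
  (of fun i => v (g i)).det * vdm g

theorem normMinor_comp_perm {d : ℕ} (v : ℕ → Fin d → ℝ) (g : Fin d → ℕ)
    (σ : Equiv.Perm (Fin d)) : normMinor v (g ∘ σ) = normMinor v g := by
  have h1 : (of fun i => v ((g ∘ σ) i)).det = σ.sign * (of fun i => v (g i)).det :=
    det_permute σ (of fun i => v (g i))
  have h2 : vdm (g ∘ σ) = σ.sign * vdm g := det_permute σ (vandermonde fun i => (g i : ℝ))
  rw [normMinor, normMinor, h1, h2]
  have h3 : ((σ.sign : ℤ) : ℝ) * ((σ.sign : ℤ) : ℝ) = 1 := by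
    rcases Int.units_eq_one_or σ.sign with h | h <;> simp [h]
  linear_combination ((of fun i => v (g i)).det * vdm g) * h3

theorem exists_perm_of_range_eq {d : ℕ} {α : Type*} {g h : Fin d → α} (hg : g.Injective)
    (hh : h.Injective) (e : Set.range g = Set.range h) : ∃ σ : Equiv.Perm (Fin d), g = h ∘ σ := by
  refine ⟨(Equiv.ofInjective g hg).trans
    ((Equiv.setCongr e).trans (Equiv.ofInjective h hh).symm), ?_⟩
  ext i
  simp only [Function.comp, Equiv.trans_apply]
  rw [Equiv.apply_ofInjective_symm hh]
  simp

theorem normMinor_eq_of_range_eq {d : ℕ} (v : ℕ → Fin d → ℝ) {g h : Fin d → ℕ}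
    (hg : g.Injective) (hh : h.Injective) (e : Set.range g = Set.range h) :
    normMinor v g = normMinor v h := by
  obtain ⟨σ, rfl⟩ := exists_perm_of_range_eq hg hh e
  exact normMinor_comp_perm v h σ

theorem det_ne_zero_iff_linearIndependent {d : ℕ} (w : Fin d → Fin d → ℝ) :
    (of w).det ≠ 0 ↔ LinearIndependent ℝ w := by
  rw [← isUnit_iff_ne_zero, ← isUnit_iff_isUnit_det, ← linearIndependent_rows_iff_isUnit]
  rfl

theorem linearIndepOn_range_iff_det {α : Type*} {d : ℕ} {v : α → Fin d → ℝ} {g : Fin d → α}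
    (hg : g.Injective) :
    LinearIndepOn ℝ v (Set.range g) ↔ (of fun i => v (g i)).det ≠ 0 := by
  rw [det_ne_zero_iff_linearIndependent]
  exact _root_.linearIndepOn_range_iff hg v

theorem injective_of_det_ne_zero {α : Type*} {d : ℕ} {v : α → Fin d → ℝ} {g : Fin d → α}
    (h : (of fun i => v (g i)).det ≠ 0) : g.Injective := by
  rw [det_ne_zero_iff_linearIndependent] at h
  exact fun i j hij => h.injective (by simp only [hij])

theorem normMinor_ne_zero {d : ℕ} {v : ℕ → Fin d → ℝ} {g : Fin d → ℕ}
    (h : (of fun i => v (g i)).det ≠ 0) : normMinor v g ≠ 0 :=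
  mul_ne_zero h (vdm_ne_zero (injective_of_det_ne_zero h))

theorem det_map_linearEquiv {d : ℕ} (L : (Fin d → ℝ) ≃ₗ[ℝ] (Fin d → ℝ)) (w : Fin d → Fin d → ℝ) :
    (of fun i => L (w i)).det = LinearMap.det (L : (Fin d → ℝ) →ₗ[ℝ] Fin d → ℝ) * (of w).det := by
  have h := (Pi.basisFun ℝ (Fin d)).det_comp (L : (Fin d → ℝ) →ₗ[ℝ] Fin d → ℝ) w
  rw [Pi.basisFun_det] at h
  exact h

/-- The determinant of a block diagonal matrix, given by its rows. -/
theorem det_append_block {r s : ℕ} (w : Fin r → Fin r → ℝ) (u : Fin s → Fin s → ℝ) :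
    (of fun i : Fin (r + s) => Fin.append (fun i => Fin.append (w i) (0 : Fin s → ℝ))
      (fun j => Fin.append (0 : Fin r → ℝ) (u j)) i).det = (of w).det * (of u).det := by
  rw [← det_fromBlocks_zero₂₁ (of w) 0 (of u), ← det_submatrix_equiv_self finSumFinEquiv]
  congr 1
  ext i j
  rcases i with i | i <;> rcases j with j | j <;> simp

/-! ### Sign-coherent representations of matroids -/

/-- `M` is the matroid of the vector configuration `v`, which spans `ℝ ^ d` and all of whose
nonzero maximal minors, with columns in increasing order, have the sign of `c`. Elements outside
the ground set are dependent, that is, they are sent to the zero vector. -/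
structure IsPosRep (M : Matroid ℕ) {d : ℕ} (v : ℕ → Fin d → ℝ) (c : ℝ) : Prop where
  ne_zero : c ≠ 0
  indep_iff : ∀ I, M.Indep I ↔ LinearIndepOn ℝ v I
  span_eq : Submodule.span ℝ (Set.range v) = ⊤
  nonneg : ∀ g : Fin d → ℕ, 0 ≤ c * normMinor v g

/-- `M` has a sign-coherent representation: `M` is a positroid on its ground set, a set of
natural numbers. -/
def PosRep (M : Matroid ℕ) : Prop :=
  ∃ (d : ℕ) (v : ℕ → Fin d → ℝ) (c : ℝ), IsPosRep M v c

theorem IsPosRep.map_linearEquiv {M : Matroid ℕ} {d : ℕ} {v : ℕ → Fin d → ℝ} {c : ℝ}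
    (h : IsPosRep M v c) (L : (Fin d → ℝ) ≃ₗ[ℝ] (Fin d → ℝ)) :
    IsPosRep M (fun x => L (v x)) (c * LinearMap.det (L : (Fin d → ℝ) →ₗ[ℝ] Fin d → ℝ)) where
  ne_zero := mul_ne_zero h.ne_zero (LinearEquiv.isUnit_det' L).ne_zero
  indep_iff I := by
    rw [h.indep_iff]
    exact ((L : (Fin d → ℝ) →ₗ[ℝ] Fin d → ℝ).linearIndepOn_iff_of_injOn
      (L.injective.injOn)).symm
  span_eq := by
    have : Set.range (fun x => L (v x)) = L '' Set.range v := by rw [← Set.range_comp]; rfl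
    rw [this, ← LinearEquiv.coe_coe, Submodule.span_image, h.span_eq, Submodule.map_top,
      LinearEquiv.range]
  nonneg g := by
    have := h.nonneg g
    rw [normMinor] at this ⊢
    rw [det_map_linearEquiv]
    have h2 := mul_nonneg this (mul_self_nonneg
      (LinearMap.det (L : (Fin d → ℝ) →ₗ[ℝ] Fin d → ℝ)))
    refine h2.trans_eq ?_
    ring

/-- A representation may be changed so that a given base consists of the unit vectors. -/
theorem IsPosRep.exists_standard {M : Matroid ℕ} {d : ℕ} {v : ℕ → Fin d → ℝ} {c : ℝ}
    (h : IsPosRep M v c) {g : Fin d → ℕ} (hg : (of fun i => v (g i)).det ≠ 0) :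
    ∃ (v' : ℕ → Fin d → ℝ) (c' : ℝ), IsPosRep M v' c' ∧ ∀ i, v' (g i) = Pi.single i 1 := by
  rw [det_ne_zero_iff_linearIndependent] at hg
  let b := Module.Basis.mk hg (hg.span_eq_top_of_card_eq_finrank' (by simp)).ge
  refine ⟨_, _, h.map_linearEquiv b.equivFun, fun i => ?_⟩
  have : v (g i) = b i := by simp [b]
  simp only [this]
  ext j
  simp [Module.Basis.equivFun_self, Pi.single_apply, eq_comm]

theorem exists_fin_enum {s : Set ℕ} (hs : s.Finite) :
    ∃ (k : ℕ) (g : Fin k → ℕ), g.Injective ∧ Set.range g = s := by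
  refine ⟨hs.toFinset.card, hs.toFinset.orderEmbOfFin rfl, RelEmbedding.injective _, ?_⟩
  simp

theorem finite_of_linearIndepOn {d : ℕ} {v : ℕ → Fin d → ℝ} {I : Set ℕ}
    (h : LinearIndepOn ℝ v I) : I.Finite :=
  Set.finite_coe_iff.1 (LinearIndependent.finite h)

theorem range_append {α : Type*} {r s : ℕ} (g : Fin r → α) (h : Fin s → α) :
    Set.range (Fin.append g h) = Set.range g ∪ Set.range h := by
  ext x
  constructor
  · rintro ⟨y, rfl⟩
    induction y using Fin.addCases <;> simp
  · rintro (⟨y, rfl⟩ | ⟨y, rfl⟩)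
    · exact ⟨Fin.castAdd s y, by simp⟩
    · exact ⟨Fin.natAdd r y, by simp⟩

/-- An independent tuple extends to a tuple of columns forming a basis. -/
theorem exists_append_base {d r : ℕ} {v : ℕ → Fin d → ℝ}
    (hv : Submodule.span ℝ (Set.range v) = ⊤) {k : Fin r → ℕ} (hk : k.Injective)
    (h : LinearIndepOn ℝ v (Set.range k)) :
    ∃ (s : ℕ) (j : Fin s → ℕ), r + s = d ∧ (Fin.append k j).Injective ∧
      LinearIndepOn ℝ v (Set.range (Fin.append k j)) := by
  obtain ⟨b, -, hkb, hsp, hb⟩ := exists_linearIndepOn_extension h (Set.subset_univ _)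
  have hfin := finite_of_linearIndepOn hb
  obtain ⟨s, j, hj, hjr⟩ := exists_fin_enum (hfin.subset (Set.sdiff_subset (t := Set.range k)))
  have hinj : (Fin.append k j).Injective := by
    rw [Fin.append_injective_iff]
    refine ⟨hk, hj, fun a a' e => ?_⟩
    have : j a' ∈ b \ Set.range k := hjr ▸ Set.mem_range_self a'
    exact this.2 ⟨a, e⟩
  have hr : Set.range (Fin.append k j) = b := by
    rw [range_append, hjr, Set.union_sdiff_cancel hkb]
  refine ⟨s, j, ?_, hinj, hr ▸ hb⟩
  rw [← hr] at hb hsp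
  have h1 : LinearIndependent ℝ (fun i => v (Fin.append k j i)) :=
    (linearIndepOn_range_iff hinj v).1 hb
  have h2 : ⊤ ≤ Submodule.span ℝ (Set.range fun i => v (Fin.append k j i)) := by
    rw [← hv, ← Set.image_univ, show (Set.range fun i => v (Fin.append k j i)) =
      v '' Set.range (Fin.append k j) from (Set.range_comp v _)]
    exact Submodule.span_le.2 hsp
  have h3 := Module.finrank_eq_card_basis (Module.Basis.mk h1 h2)
  simpa using h3.symm

theorem IsPosRep.mem_span {M : Matroid ℕ} {d : ℕ} {v : ℕ → Fin d → ℝ} {c : ℝ}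
    (h : IsPosRep M v c) {I R : Set ℕ} (hI : M.IsBasis' I R) {x : ℕ} (hx : x ∈ R) :
    v x ∈ Submodule.span ℝ (v '' I) := by
  by_cases hxI : x ∈ I
  · exact Submodule.subset_span (Set.mem_image_of_mem _ hxI)
  by_contra hsp
  have := ((h.indep_iff I).1 hI.indep).insert hsp
  rw [← h.indep_iff] at this
  exact hxI (hI.mem_of_insert_indep hx this)

/-- Restrictions of positroids are positroids. If a basis `I` of `R` is extended by `J` to a base
and both are sent to unit vectors, then the elements of `R` live in the coordinates indexed by
`I`; the minor at a tuple `g` in `R` is the minor of the big configuration at `g` followed by `J`,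
and rescaling `x` by `∏ j ∈ J, (j - x)` accounts for the change of the Vandermonde factor. -/
theorem PosRep.restrict {M : Matroid ℕ} (h : PosRep M) (R : Set ℕ) : PosRep (M.restrict R) := by
  classical
  obtain ⟨d, v₀, c₀, h₀⟩ := h
  obtain ⟨I, hI⟩ := M.exists_isBasis' R
  obtain ⟨r, k, hk, rfl⟩ := exists_fin_enum (finite_of_linearIndepOn ((h₀.indep_iff I).1 hI.indep))
  obtain ⟨s, j, rfl, hinj, hli⟩ :=
    exists_append_base h₀.span_eq hk ((h₀.indep_iff _).1 hI.indep)
  obtain ⟨v, c, h, hst⟩ := h₀.exists_standard ((linearIndepOn_range_iff_det hinj).1 hli)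
  have hk1 : ∀ i, v (k i) = Pi.single (Fin.castAdd s i) 1 := fun i => by
    simpa using hst (Fin.castAdd s i)
  have hj1 : ∀ i, v (j i) = Pi.single (Fin.natAdd r i) 1 := fun i => by
    simpa using hst (Fin.natAdd r i)
  have hjinj : j.Injective := (Fin.append_injective_iff.1 hinj).2.1
  have hkj : ∀ a b, k a ≠ j b := (Fin.append_injective_iff.1 hinj).2.2
  -- elements of `R` have no coordinates along `J`
  have hzero : ∀ x ∈ R, ∀ i, v x (Fin.natAdd r i) = 0 := by
    intro x hx i
    have : Submodule.span ℝ (v '' Set.range k) ≤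
        LinearMap.ker (LinearMap.proj (R := ℝ) (φ := fun _ => ℝ) (Fin.natAdd r i)) := by
      rw [Submodule.span_le]
      rintro _ ⟨_, ⟨a, rfl⟩, rfl⟩
      have hne : Fin.natAdd r i ≠ Fin.castAdd s a := by
        intro e; have := congrArg Fin.val e; simp at this; omega
      simp [hk1, hne]
    exact this (h.mem_span hI hx)
  have hjR : ∀ a, j a ∉ R := by
    intro a ha
    have := hzero _ ha a
    simp [hj1] at this
  let p : (Fin (r + s) → ℝ) →ₗ[ℝ] (Fin r → ℝ) := LinearMap.funLeft ℝ ℝ (Fin.castAdd s)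
  let t : ℕ → ℝ := fun x => ∏ b, ((j b : ℝ) - x)
  have ht : ∀ x ∈ R, t x ≠ 0 := by
    intro x hx
    refine Finset.prod_ne_zero_iff.2 fun b _ => sub_ne_zero.2 fun e => ?_
    exact hjR b (Nat.cast_injective e ▸ hx)
  let w : ℕ → Fin r → ℝ := fun x => if x ∈ R then t x • p (v x) else 0
  have hwR : ∀ x ∈ R, w x = t x • p (v x) := fun x hx => if_pos hx
  have hwn : ∀ x, x ∉ R → w x = 0 := fun x hx => if_neg hx
  have hkR : ∀ i, k i ∈ R := fun i => hI.subset (Set.mem_range_self i)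
  have hpinj : ∀ K ⊆ R, Set.InjOn p (Submodule.span ℝ (v '' K)) := by
    intro K hK x hx y hy hxy
    have hz : ∀ z ∈ Submodule.span ℝ (v '' K), ∀ i, z (Fin.natAdd r i) = 0 := by
      intro z hz i
      have : Submodule.span ℝ (v '' K) ≤
          LinearMap.ker (LinearMap.proj (R := ℝ) (φ := fun _ => ℝ) (Fin.natAdd r i)) := by
        rw [Submodule.span_le]
        rintro _ ⟨a, ha, rfl⟩
        exact hzero a (hK ha) i
      exact this hz
    ext i
    induction i using Fin.addCases with
    | left i => exact congrFun hxy i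
    | right i => rw [hz x hx, hz y hy]
  refine ⟨r, w, c * vdm j, mul_ne_zero h.ne_zero (vdm_ne_zero hjinj), ?_, ?_, ?_⟩
  · intro K
    rw [Matroid.restrict_indep_iff, h.indep_iff]
    have key : ∀ K ⊆ R, (LinearIndepOn ℝ w K ↔ LinearIndepOn ℝ v K) := by
      intro K hK
      rw [← p.linearIndepOn_iff_of_injOn (hpinj K hK)]
      have := LinearIndependent.units_smul_iff (R := ℝ) (v := fun x : K => p (v x))
        (fun x : K => Units.mk0 (t x) (ht x (hK x.2)))
      rw [LinearIndepOn, LinearIndepOn, ← iff_comm, ← iff_comm]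
      refine Iff.trans (Eq.to_iff ?_) this
      congr 1
      ext x : 1
      exact hwR x (hK x.2)
    constructor
    · rintro ⟨h1, h2⟩; exact (key K h2).2 h1
    · intro hw
      have hKR : K ⊆ R := fun x hx => by
        by_contra hxR
        exact hw.ne_zero hx (hwn x hxR)
      exact ⟨(key K hKR).1 hw, hKR⟩
  · rw [eq_top_iff, ← (Pi.basisFun ℝ (Fin r)).span_eq, Submodule.span_le]
    rintro _ ⟨i, rfl⟩
    have : Pi.basisFun ℝ (Fin r) i = (t (k i))⁻¹ • w (k i) := by
      rw [hwR _ (hkR i), smul_smul, inv_mul_cancel₀ (ht _ (hkR i)), one_smul, hk1]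
      ext a
      simp [p, LinearMap.funLeft_apply, Pi.single_apply]
    rw [this]
    exact Submodule.smul_mem _ _ (Submodule.subset_span (Set.mem_range_self _))
  · intro g
    by_cases hg : ∀ i, g i ∈ R
    · have h1 := h.nonneg (Fin.append g j)
      have h2 : (of fun i => w (g i)).det =
          (∏ i, t (g i)) * (of fun i => p (v (g i))).det := by
        rw [← det_mul_column]
        congr 1; ext a b
        simp [hwR _ (hg a)]
      have h3 : (of fun i => v (Fin.append g j i)).det = (of fun i => p (v (g i))).det := by
        have := det_append_block (fun i => p (v (g i))) (fun a : Fin s => Pi.single a 1)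
        have h1 : (of fun a : Fin s => (Pi.single a 1 : Fin s → ℝ)).det = 1 := by
          rw [← det_one (n := Fin s)]; congr 1; ext a b
          simp [Matrix.one_apply, Pi.single_apply, eq_comm]
        rw [h1, mul_one] at this
        rw [← this]
        congr 1; ext a b
        induction a using Fin.addCases with
        | left a => induction b using Fin.addCases with
          | left b => simp [p, LinearMap.funLeft_apply]
          | right b => simp [hzero _ (hg a)]
        | right a => induction b using Fin.addCases with
          | left b =>
            have hne : Fin.castAdd s b ≠ Fin.natAdd r a := by
              intro e; have := congrArg Fin.val e; simp at this; omega
            simp [hj1, hne]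
          | right b => simp [hj1, Pi.single_apply]
      rw [normMinor, h3, vdm_append] at h1
      rw [normMinor, h2]
      convert h1 using 1
      simp only [t]
      ring
    · obtain ⟨i, hi⟩ := not_forall.1 hg
      have : (of fun i => w (g i)).det = 0 :=
        det_eq_zero_of_row_eq_zero i fun a => by simp [hwn _ hi]
      rw [normMinor, this]; simp

/-! ### Direct sums of positroids -/

/-- The inclusion of `ℝ ^ r` into `ℝ ^ (r + s)` as the first coordinates. -/
def appendLeft (r s : ℕ) : (Fin r → ℝ) →ₗ[ℝ] (Fin (r + s) → ℝ) where
  toFun u := Fin.append u 0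
  map_add' u w := by ext i; induction i using Fin.addCases <;> simp
  map_smul' a u := by ext i; induction i using Fin.addCases <;> simp

/-- The inclusion of `ℝ ^ s` into `ℝ ^ (r + s)` as the last coordinates. -/
def appendRight (r s : ℕ) : (Fin s → ℝ) →ₗ[ℝ] (Fin (r + s) → ℝ) where
  toFun u := Fin.append 0 u
  map_add' u w := by ext i; induction i using Fin.addCases <;> simp
  map_smul' a u := by ext i; induction i using Fin.addCases <;> simp

theorem appendLeft_apply {r s : ℕ} (u : Fin r → ℝ) : appendLeft r s u = Fin.append u 0 := rfl

theorem appendRight_apply {r s : ℕ} (u : Fin s → ℝ) : appendRight r s u = Fin.append 0 u := rfl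

theorem appendLeft_injective (r s : ℕ) : Function.Injective (appendLeft r s) := by
  intro u w h
  ext i
  simpa [appendLeft_apply] using congrFun h (Fin.castAdd s i)

theorem appendRight_injective (r s : ℕ) : Function.Injective (appendRight r s) := by
  intro u w h
  ext i
  simpa [appendRight_apply] using congrFun h (Fin.natAdd r i)

theorem disjoint_range_append (r s : ℕ) :
    Disjoint (LinearMap.range (appendLeft r s)) (LinearMap.range (appendRight r s)) := by
  rw [Submodule.disjoint_def]
  rintro _ ⟨u, rfl⟩ ⟨w, hw⟩
  ext i
  induction i using Fin.addCases with
  | left i => simpa [appendLeft_apply, appendRight_apply] using (congrFun hw (Fin.castAdd s i)).symm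
  | right i => simp [appendLeft_apply]

theorem IsPosRep.eq_zero {M : Matroid ℕ} {d : ℕ} {v : ℕ → Fin d → ℝ} {c : ℝ}
    (h : IsPosRep M v c) {x : ℕ} (hx : x ∉ M.E) : v x = 0 := by
  by_contra hv
  have := (h.indep_iff {x}).2 (LinearIndepOn.singleton hv)
  exact hx (this.subset_ground rfl)

theorem linearIndepOn_smul_iff {ι V : Type*} [AddCommGroup V] [Module ℝ V] {v : ι → V} {t : ι → ℝ}
    {K : Set ι} (ht : ∀ x ∈ K, t x ≠ 0) :
    LinearIndepOn ℝ (fun x => t x • v x) K ↔ LinearIndepOn ℝ v K :=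
  LinearIndependent.units_smul_iff (R := ℝ) (v := fun x : K => v x)
    (fun x : K => Units.mk0 (t x) (ht x x.2))

theorem ncard_le_of_linearIndepOn {d : ℕ} {v : ℕ → Fin d → ℝ} {I : Set ℕ}
    (h : LinearIndepOn ℝ v I) : I.ncard ≤ d := by
  have := (finite_of_linearIndepOn h).fintype
  rw [← Nat.card_coe_set_eq, Nat.card_eq_fintype_card]
  have h2 := LinearIndependent.fintype_card_le_finrank h
  simpa using h2

/-- The direct sum of two positroids whose ground sets do not cross (for no two elements of the
second ground set is there an element of the first one in between) is a positroid. Block diagonal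
configurations represent the sum; moving the columns of the second block to their place in the
ordering changes the sign of a minor by a product of factors that only depend on the columns of
the first block, which is compensated by rescaling these by powers of `η`. -/
theorem PosRep.disjointSum {M₁ M₂ : Matroid ℕ} (h₁ : PosRep M₁) (h₂ : PosRep M₂)
    (hd : Disjoint M₁.E M₂.E) (η : ℕ → ℝ) (hη : ∀ x, η x ≠ 0)
    (hs : ∀ x ∈ M₁.E, ∀ y ∈ M₂.E, 0 ≤ η x * ((y : ℝ) - x)) :
    PosRep (M₁.disjointSum M₂ hd) := by
  obtain ⟨r, v₁, c₁, h₁⟩ := h₁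
  obtain ⟨s, v₂, c₂, h₂⟩ := h₂
  let t : ℕ → ℝ := fun x => η x ^ s
  have ht : ∀ x, t x ≠ 0 := fun x => pow_ne_zero _ (hη x)
  let v : ℕ → Fin (r + s) → ℝ := fun x => Fin.append (t x • v₁ x) (v₂ x)
  have hv1 : ∀ x ∈ M₁.E, v x = appendLeft r s (t x • v₁ x) := fun x hx => by
    simp only [v, h₂.eq_zero (fun h => hd.le_bot ⟨hx, h⟩), appendLeft_apply]
  have hv2 : ∀ x ∈ M₂.E, v x = appendRight r s (v₂ x) := fun x hx => by
    simp only [v, h₁.eq_zero (fun h => hd.le_bot ⟨h, hx⟩), appendRight_apply, smul_zero]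
  have hv0 : ∀ x, x ∉ M₁.E → x ∉ M₂.E → v x = 0 := fun x hx hx' => by
    simp only [v, h₁.eq_zero hx, h₂.eq_zero hx', smul_zero]
    ext i; induction i using Fin.addCases <;> simp
  have hi1 : ∀ K ⊆ M₁.E, (LinearIndepOn ℝ v K ↔ LinearIndepOn ℝ v₁ K) := fun K hK => by
    rw [linearIndepOn_congr (fun x hx => hv1 x (hK hx)),
      ← linearIndepOn_smul_iff (v := v₁) (t := t) fun x _ => ht x]
    exact (appendLeft r s).linearIndepOn_iff_of_injOn (v := fun x => t x • v₁ x)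
      (appendLeft_injective r s).injOn
  have hi2 : ∀ K ⊆ M₂.E, (LinearIndepOn ℝ v K ↔ LinearIndepOn ℝ v₂ K) := fun K hK => by
    rw [linearIndepOn_congr (fun x hx => hv2 x (hK hx))]
    exact (appendRight r s).linearIndepOn_iff_of_injOn (v := v₂) (appendRight_injective r s).injOn
  have hground : ∀ I, LinearIndepOn ℝ v I → I ⊆ M₁.E ∪ M₂.E := fun I hI x hx => by
    by_contra hn
    simp only [Set.mem_union, not_or] at hn
    exact hI.ne_zero hx (hv0 x hn.1 hn.2)
  refine ⟨r + s, v, c₁ * c₂, mul_ne_zero h₁.ne_zero h₂.ne_zero, ?_, ?_, ?_⟩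
  · intro I
    have hsplit : ∀ I ⊆ M₁.E ∪ M₂.E, (LinearIndepOn ℝ v I ↔
        LinearIndepOn ℝ v (I ∩ M₁.E) ∧ LinearIndepOn ℝ v (I ∩ M₂.E)) := fun I hI => by
      conv_lhs => rw [← Set.inter_eq_left.2 hI, Set.inter_union_distrib_left]
      rw [linearIndepOn_union_iff (hd.mono Set.inter_subset_right Set.inter_subset_right)]
      have hdis : Disjoint (Submodule.span ℝ (v '' (I ∩ M₁.E)))
          (Submodule.span ℝ (v '' (I ∩ M₂.E))) := by
        refine (disjoint_range_append r s).mono ?_ ?_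
        · rw [Submodule.span_le]
          rintro _ ⟨x, hx, rfl⟩
          exact ⟨_, (hv1 x hx.2).symm⟩
        · rw [Submodule.span_le]
          rintro _ ⟨x, hx, rfl⟩
          exact ⟨_, (hv2 x hx.2).symm⟩
      simp [hdis]
    rw [Matroid.disjointSum_indep_iff, h₁.indep_iff, h₂.indep_iff,
      ← hi1 _ Set.inter_subset_right, ← hi2 _ Set.inter_subset_right]
    constructor
    · rintro ⟨ha, hb, hc⟩
      exact (hsplit I hc).2 ⟨ha, hb⟩
    · intro h
      have hg := hground I h
      exact ⟨((hsplit I hg).1 h).1, ((hsplit I hg).1 h).2, hg⟩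
  · have e1 : ∀ u, appendLeft r s u ∈ Submodule.span ℝ (Set.range v) := by
      have : Submodule.span ℝ (Set.range v₁) ≤
          (Submodule.span ℝ (Set.range v)).comap (appendLeft r s) := by
        rw [Submodule.span_le]
        rintro _ ⟨x, rfl⟩
        by_cases hx : x ∈ M₁.E
        · have : appendLeft r s (v₁ x) = (t x)⁻¹ • v x := by
            rw [hv1 x hx, map_smul, smul_smul, inv_mul_cancel₀ (ht x), one_smul]
          simp only [Submodule.comap_coe, Set.mem_preimage, this]
          exact Submodule.smul_mem _ _ (Submodule.subset_span (Set.mem_range_self x))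
        · simp [h₁.eq_zero hx]
      intro u
      exact this (h₁.span_eq ▸ Submodule.mem_top)
    have e2 : ∀ u, appendRight r s u ∈ Submodule.span ℝ (Set.range v) := by
      have : Submodule.span ℝ (Set.range v₂) ≤
          (Submodule.span ℝ (Set.range v)).comap (appendRight r s) := by
        rw [Submodule.span_le]
        rintro _ ⟨x, rfl⟩
        by_cases hx : x ∈ M₂.E
        · simp only [Submodule.comap_coe, Set.mem_preimage, ← hv2 x hx]
          exact Submodule.subset_span (Set.mem_range_self x)
        · simp [h₂.eq_zero hx]
      intro u
      exact this (h₂.span_eq ▸ Submodule.mem_top)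
    rw [eq_top_iff]
    intro u _
    have : u = appendLeft r s (fun i => u (Fin.castAdd s i)) +
        appendRight r s (fun i => u (Fin.natAdd r i)) := by
      ext i; induction i using Fin.addCases <;> simp [appendLeft_apply, appendRight_apply]
    rw [this]
    exact add_mem (e1 _) (e2 _)
  · intro g
    by_cases hdet : (of fun i => v (g i)).det = 0
    · simp [normMinor, hdet]
    -- a base meets the two ground sets in `r` and `s` elements, which are listed separately
    have hinj := injective_of_det_ne_zero hdet
    have hli := (linearIndepOn_range_iff_det hinj).2 hdet
    have hg := hground _ hli
    have hfin : (Set.range g).Finite := Set.finite_range g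
    have hu : (Set.range g ∩ M₁.E) ∪ (Set.range g ∩ M₂.E) = Set.range g := by
      rw [← Set.inter_union_distrib_left, Set.inter_eq_left.2 hg]
    have hcard : (Set.range g ∩ M₁.E).ncard + (Set.range g ∩ M₂.E).ncard = r + s := by
      rw [← Set.ncard_union_eq (hd.mono Set.inter_subset_right Set.inter_subset_right)
        (hfin.subset Set.inter_subset_left) (hfin.subset Set.inter_subset_left), hu,
        ← Nat.card_coe_set_eq, Nat.card_congr (Equiv.ofInjective g hinj).symm]
      simp
    have c1 := ncard_le_of_linearIndepOn
      ((hi1 _ Set.inter_subset_right).1 (hli.mono (Set.inter_subset_left (t := M₁.E))))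
    have c2 := ncard_le_of_linearIndepOn
      ((hi2 _ Set.inter_subset_right).1 (hli.mono (Set.inter_subset_left (t := M₂.E))))
    have henum : ∀ (A : Set ℕ) (k : ℕ), A.Finite → A.ncard = k →
        ∃ f : Fin k → ℕ, f.Injective ∧ Set.range f = A := by
      intro A k hA hk
      obtain ⟨k', f, hf, rfl⟩ := exists_fin_enum hA
      rw [← Nat.card_coe_set_eq, Nat.card_congr (Equiv.ofInjective f hf).symm,
        Nat.card_eq_fintype_card, Fintype.card_fin] at hk
      subst hk
      exact ⟨f, hf, rfl⟩
    obtain ⟨g₁, hg₁, hr₁⟩ := henum _ r (hfin.subset (Set.inter_subset_left (t := M₁.E))) (by omega)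
    obtain ⟨g₂, hg₂, hr₂⟩ := henum _ s (hfin.subset (Set.inter_subset_left (t := M₂.E))) (by omega)
    have m1 : ∀ i, g₁ i ∈ M₁.E := fun i => (hr₁ ▸ Set.mem_range_self i : g₁ i ∈ _ ∩ M₁.E).2
    have m2 : ∀ i, g₂ i ∈ M₂.E := fun i => (hr₂ ▸ Set.mem_range_self i : g₂ i ∈ _ ∩ M₂.E).2
    have hainj : (Fin.append g₁ g₂).Injective :=
      Fin.append_injective_iff.2 ⟨hg₁, hg₂, fun i j e => hd.le_bot ⟨m1 i, e ▸ m2 j⟩⟩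
    rw [normMinor_eq_of_range_eq v hinj hainj (by rw [range_append, hr₁, hr₂, hu])]
    have hblock : (of fun i => v (Fin.append g₁ g₂ i)).det =
        (∏ i, t (g₁ i)) * (of fun i => v₁ (g₁ i)).det * (of fun i => v₂ (g₂ i)).det := by
      rw [← det_mul_column]
      have := det_append_block (fun i => t (g₁ i) • v₁ (g₁ i)) (fun i => v₂ (g₂ i))
      refine Eq.trans ?_ (this.trans rfl)
      congr 1
      ext a b
      induction a using Fin.addCases with
      | left a =>
        rw [of_apply, Fin.append_left, of_apply, Fin.append_left, hv1 _ (m1 a), appendLeft_apply]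
      | right a => simp [hv2 _ (m2 a), appendRight_apply]
    have hsign : 0 ≤ (∏ i, t (g₁ i)) * ∏ i, ∏ j, ((g₂ j : ℝ) - g₁ i) := by
      rw [← Finset.prod_mul_distrib]
      refine Finset.prod_nonneg fun i _ => ?_
      have : t (g₁ i) = ∏ _j : Fin s, η (g₁ i) := by simp [t]
      rw [this, ← Finset.prod_mul_distrib]
      exact Finset.prod_nonneg fun j _ => hs _ (m1 i) _ (m2 j)
    have := mul_nonneg (mul_nonneg (h₁.nonneg g₁) (h₂.nonneg g₂)) hsign
    refine this.trans_eq ?_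
    rw [normMinor, normMinor, normMinor, hblock, vdm_append]
    ring

/-! ### Circuits of a positroid do not cross -/

theorem det_update_add_smul {d : ℕ} (w : Fin d → Fin d → ℝ) (i : Fin d) (x u : Fin d → ℝ) (a : ℝ)
    (hu : u ∈ Submodule.span ℝ (w '' {i}ᶜ)) :
    (of (Function.update w i (a • x + u))).det = a * (of (Function.update w i x)).det := by
  have h0 : (of (Function.update w i u)).det = 0 := by
    have : Submodule.span ℝ (w '' {i}ᶜ) ≤
        LinearMap.ker ((detRowAlternating (R := ℝ)).toMultilinearMap.toLinearMap w i) := by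
      rw [Submodule.span_le]
      rintro _ ⟨j, hj, rfl⟩
      exact (detRowAlternating (R := ℝ)).map_update_self w (Ne.symm hj)
    exact this hu
  have h1 := (detRowAlternating (R := ℝ)).map_update_add w i (a • x) u
  have h2 := (detRowAlternating (R := ℝ)).map_update_smul w i a x
  change (of (Function.update w i (a • x + u))).det = (of (Function.update w i (a • x))).det +
    (of (Function.update w i u)).det at h1
  change (of (Function.update w i (a • x))).det = a • (of (Function.update w i x)).det at h2
  rw [h1, h2, h0, add_zero, smul_eq_mul]

/-- In a circuit containing `a ≠ c`, the vector of `c` is a nonzero multiple of the vector of `a`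
modulo the span of the rest of the circuit. -/
theorem IsPosRep.exists_circuit_coeff {M : Matroid ℕ} {d : ℕ} {v : ℕ → Fin d → ℝ} {c₀ : ℝ}
    (h : IsPosRep M v c₀) {C : Set ℕ} (hC : M.IsCircuit C) {a c : ℕ} (ha : a ∈ C) (hc : c ∈ C)
    (hac : a ≠ c) :
    ∃ l : ℝ, l ≠ 0 ∧ ∃ u ∈ Submodule.span ℝ (v '' (C \ {a, c})), v c = l • v a + u := by
  have h1 := (h.indep_iff _).1 (hC.sdiff_singleton_indep hc)
  have h2 : ¬ LinearIndepOn ℝ v C := fun hh => hC.not_indep ((h.indep_iff _).2 hh)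
  have h3 : v c ∈ Submodule.span ℝ (v '' (C \ {c})) := by
    by_contra hn
    have := h1.insert hn
    rw [Set.insert_sdiff_singleton, Set.insert_eq_of_mem hc] at this
    exact h2 this
  have e : C \ {c} = insert a (C \ {a, c}) := by
    ext x
    by_cases hx : x = a
    · subst hx; simp [ha, hac]
    · simp [hx]
  rw [e, Set.image_insert_eq, Submodule.mem_span_insert] at h3
  obtain ⟨l, u, hu, hvc⟩ := h3
  refine ⟨l, ?_, u, hu, hvc⟩
  rintro rfl
  rw [zero_smul, zero_add] at hvc
  have h4 := (h.indep_iff _).1 (hC.sdiff_singleton_indep ha)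
  have e2 : C \ {a} = insert c (C \ {a, c}) := by
    ext x
    by_cases hx : x = c
    · subst hx; simp [hc, hac.symm]
    · simp [hx]
  rw [e2] at h4
  rw [linearIndepOn_insert (by simp)] at h4
  exact h4.2 (hvc ▸ hu)

/-- Circuits `C ∋ a, c` and `C' ∋ b, d` of a positroid that can be broken independently do not
cross, where `hcross` says that exactly one of `b` and `d` lies between `a` and `c`: extending
`C \ {c} ∪ C' \ {d}` to a base `{a, b} ∪ J`, also `{c, b} ∪ J`, `{a, d} ∪ J` and `{c, d} ∪ J` are
bases, and the product of the four minors has the wrong sign. -/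
theorem PosRep.not_crossing {M : Matroid ℕ} (h : PosRep M) {C C' : Set ℕ} (hC : M.IsCircuit C)
    (hC' : M.IsCircuit C') {a b c d : ℕ} (ha : a ∈ C) (hc : c ∈ C) (hb : b ∈ C') (hd : d ∈ C')
    (hdis : Disjoint C C') (hI : M.Indep ((C \ {c}) ∪ (C' \ {d})))
    (hcross : ((b : ℝ) - a) * (b - c) * (d - a) * (d - c) < 0) : False := by
  obtain ⟨n, v, c₀, h⟩ := h
  have hac : a ≠ c := by rintro rfl; nlinarith [mul_self_nonneg (((b : ℝ) - a) * (d - a))]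
  have hbd : b ≠ d := by rintro rfl; nlinarith [mul_self_nonneg (((b : ℝ) - a) * (b - c))]
  have hCne : ∀ {x y : ℕ}, x ∈ C → y ∈ C' → x ≠ y := fun hx hy e => hdis.le_bot ⟨hx, e ▸ hy⟩
  obtain ⟨l, hl, u, hu, hvc⟩ := h.exists_circuit_coeff hC ha hc hac
  obtain ⟨m, hm, u', hu', hvd⟩ := h.exists_circuit_coeff hC' hb hd hbd
  have hvI := (h.indep_iff _).1 hI
  set I : Set ℕ := (C \ {c}) ∪ (C' \ {d}) with hIdef
  have haI : a ∈ I := Or.inl ⟨ha, hac⟩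
  have hbI : b ∈ I := Or.inr ⟨hb, hbd⟩
  obtain ⟨q, f, hf, hfr⟩ := exists_fin_enum
    ((finite_of_linearIndepOn hvI).subset (Set.sdiff_subset (t := {a, b})))
  let k : Fin (2 + q) → ℕ := Fin.append ![a, b] f
  have hkr : Set.range k = I := by
    rw [range_append, hfr]
    simp only [Matrix.range_cons, Matrix.range_empty, Set.union_empty]
    ext x
    by_cases hxa : x = a
    · subst hxa; simp [haI]
    by_cases hxb : x = b
    · subst hxb; simp [hbI]
    simp [hxa, hxb]
  have hkinj : k.Injective := by
    rw [Fin.append_injective_iff]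
    refine ⟨?_, hf, ?_⟩
    · intro i j hij
      fin_cases i <;> fin_cases j <;> simp_all [hCne ha hb, (hCne ha hb).symm]
    · intro i j e
      have : f j ∈ I \ {a, b} := hfr ▸ Set.mem_range_self j
      fin_cases i <;> simp_all
  obtain ⟨s, j, hsn, hinj, hli⟩ := exists_append_base h.span_eq hkinj (hkr ▸ hvI)
  obtain rfl : n = 2 + (q + s) := by omega
  -- the tuples `x, y` followed by the common part of the four bases
  let J : Fin (q + s) → ℕ := Fin.append f j
  let T : ℕ → ℕ → Fin (2 + (q + s)) → ℕ := fun x y => Fin.append ![x, y] J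
  have hTr : Set.range (T a b) = Set.range (Fin.append k j) := by
    simp only [T, J, k, range_append, Set.union_assoc]
  have hTdet : (of fun i => v (T a b i)).det ≠ 0 := by
    have hTinj : (T a b).Injective := by
      have e : Fin.append k j = T a b ∘ Fin.cast hsn := Fin.append_assoc _ _ _
      rw [e] at hinj
      exact (Function.Injective.of_comp_iff' _ (finCongr hsn).bijective).1 hinj
    rw [← linearIndepOn_range_iff_det hTinj, hTr]
    exact hli
  let i0 : Fin (2 + (q + s)) := Fin.castAdd _ 0
  let i1 : Fin (2 + (q + s)) := Fin.castAdd _ 1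
  have hn0 : ∀ i : Fin (q + s), Fin.natAdd 2 i ≠ i0 := by
    intro i e; have := congrArg Fin.val e; simp [i0] at this
  have hn1 : ∀ i : Fin (q + s), Fin.natAdd 2 i ≠ i1 := by
    intro i e; have := congrArg Fin.val e; simp [i1] at this; omega
  have hT0 : ∀ x y x', T x' y = Function.update (T x y) i0 x' := by
    intro x y x'
    ext i
    induction i using Fin.addCases with
    | left i => fin_cases i <;> simp [T, i0]
    | right i => simp [T, hn0 i]
  have hT1 : ∀ x y y', T x y' = Function.update (T x y) i1 y' := by
    intro x y x'
    ext i
    induction i using Fin.addCases with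
    | left i => fin_cases i <;> simp [T, i1]
    | right i => simp [T, hn1 i]
  have hI1 : ∀ x ∈ I, x ≠ a → x ≠ b → ∃ i, J i = x := by
    intro x hx hxa hxb
    have : x ∈ Set.range f := hfr ▸ ⟨hx, by simp [hxa, hxb]⟩
    obtain ⟨i, rfl⟩ := this
    exact ⟨Fin.castAdd s i, by simp [J]⟩
  have hw : ∀ x y, (fun i => v (T x y i)) ∘ Fin.natAdd 2 = fun i => v (J i) := by
    intro x y; ext i : 1; simp [T]
  -- replacing `a` by `c`, or `b` by `d`, multiplies minors by `l`, or `m`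
  have D0 : ∀ y, (of fun i => v (T c y i)).det = l * (of fun i => v (T a y i)).det := by
    intro y
    have hmem : u ∈ Submodule.span ℝ ((fun i => v (T a y i)) '' {i0}ᶜ) := by
      refine Submodule.span_mono ?_ hu
      rintro _ ⟨x, hx, rfl⟩
      simp only [Set.mem_sdiff, Set.mem_insert_iff, Set.mem_singleton_iff, not_or] at hx
      obtain ⟨i, hi⟩ := hI1 x (Or.inl ⟨hx.1, hx.2.2⟩) hx.2.1 (hCne hx.1 hb)
      exact ⟨Fin.natAdd 2 i, hn0 i, by rw [← hi]; exact congrFun (hw a y) i⟩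
    have := det_update_add_smul (fun i => v (T a y i)) i0 (v a) u l hmem
    rw [← hvc] at this
    convert this using 3
    · ext i : 1
      rw [hT0 a y c]
      by_cases hi : i = i0
      · subst hi; simp
      · simp [hi]
    · congr 1
      ext i : 1
      by_cases hi : i = i0
      · subst hi; simp [T, i0]
      · simp [hi]
  have D1 : ∀ x, (of fun i => v (T x d i)).det = m * (of fun i => v (T x b i)).det := by
    intro y
    have hmem : u' ∈ Submodule.span ℝ ((fun i => v (T y b i)) '' {i1}ᶜ) := by
      refine Submodule.span_mono ?_ hu'
      rintro _ ⟨x, hx, rfl⟩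
      simp only [Set.mem_sdiff, Set.mem_insert_iff, Set.mem_singleton_iff, not_or] at hx
      obtain ⟨i, hi⟩ := hI1 x (Or.inr ⟨hx.1, hx.2.2⟩) (hCne ha hx.1).symm hx.2.1
      exact ⟨Fin.natAdd 2 i, hn1 i, by rw [← hi]; exact congrFun (hw y b) i⟩
    have := det_update_add_smul (fun i => v (T y b i)) i1 (v b) u' m hmem
    rw [← hvd] at this
    convert this using 3
    · ext i : 1
      rw [hT1 y b d]
      by_cases hi : i = i1
      · subst hi; simp
      · simp [hi]
    · congr 1
      ext i : 1
      by_cases hi : i = i1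
      · subst hi; simp [T, i1]
      · simp [hi]
  have V : ∀ x y : ℕ, vdm (T x y) = ((y : ℝ) - x) * vdm J *
      ((∏ i, ((J i : ℝ) - x)) * ∏ i, ((J i : ℝ) - y)) := by
    intro x y
    have : vdm ![x, y] = (y : ℝ) - x := by
      simp [vdm_eq_prod, Fin.prod_univ_two]
    simp only [T, vdm_append, this, Fin.prod_univ_two]
    simp
  have N1 := h.nonneg (T a b)
  have N2 := h.nonneg (T c b)
  have N3 := h.nonneg (T a d)
  have N4 := h.nonneg (T c d)
  set δ := (of fun i => v (T a b i)).det with hδ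
  have Z1 : normMinor v (T a b) ≠ 0 := normMinor_ne_zero hTdet
  have Z2 : normMinor v (T c b) ≠ 0 := normMinor_ne_zero (by rw [D0]; exact mul_ne_zero hl hTdet)
  have Z3 : normMinor v (T a d) ≠ 0 := normMinor_ne_zero (by rw [D1]; exact mul_ne_zero hm hTdet)
  have Z4 : normMinor v (T c d) ≠ 0 := normMinor_ne_zero
    (by rw [D1, D0]; exact mul_ne_zero hm (mul_ne_zero hl hTdet))
  have P1 : 0 < (c₀ * normMinor v (T a b)) * (c₀ * normMinor v (T c b)) *
      ((c₀ * normMinor v (T a d)) * (c₀ * normMinor v (T c d))) := by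
    have hc₀ := h.ne_zero
    refine lt_of_le_of_ne (mul_nonneg (mul_nonneg N1 N2) (mul_nonneg N3 N4)) (Ne.symm ?_)
    exact mul_ne_zero (mul_ne_zero (mul_ne_zero hc₀ Z1) (mul_ne_zero hc₀ Z2))
      (mul_ne_zero (mul_ne_zero hc₀ Z3) (mul_ne_zero hc₀ Z4))
  simp only [normMinor, D1, D0, ← hδ, V] at P1
  set p := ∏ i, ((J i : ℝ) - a)
  set p' := ∏ i, ((J i : ℝ) - b)
  set p'' := ∏ i, ((J i : ℝ) - c)
  set p''' := ∏ i, ((J i : ℝ) - d)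
  have P2 := mul_nonneg_of_nonpos_of_nonpos hcross.le
    (neg_nonpos.2 (mul_self_nonneg (c₀ ^ 2 * δ ^ 2 * l * m * vdm J ^ 2 * p * p' * p'' * p''')))
  have : (c₀ * (δ * (((b : ℝ) - a) * vdm J * (p * p')))) *
      (c₀ * (l * δ * (((b : ℝ) - c) * vdm J * (p'' * p')))) *
      ((c₀ * (m * δ * (((d : ℝ) - a) * vdm J * (p * p''')))) *
      (c₀ * (m * (l * δ) * (((d : ℝ) - c) * vdm J * (p'' * p'''))))) =
      -(((b : ℝ) - a) * (b - c) * (d - a) * (d - c) *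
        -((c₀ ^ 2 * δ ^ 2 * l * m * vdm J ^ 2 * p * p' * p'' * p''') *
        (c₀ ^ 2 * δ ^ 2 * l * m * vdm J ^ 2 * p * p' * p'' * p'''))) := by ring
  linarith [this ▸ P1]

/-! ### Separators and connected components of matroids -/

/-- A set is a separator of `M` if no circuit crosses it. -/
def IsSep {α : Type*} (M : Matroid α) (T : Set α) : Prop :=
  ∀ C, M.IsCircuit C → C ⊆ T ∨ Disjoint C T

/-- A connected component of `M`, that is, a minimal nonempty separator. -/
structure IsComp {α : Type*} (M : Matroid α) (S : Set α) : Prop where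
  subset_ground : S ⊆ M.E
  nonempty : S.Nonempty
  isSep : IsSep M S
  minimal : ∀ T ⊆ S, IsSep M T → T = ∅ ∨ T = S

section Separators

variable {α : Type*} {M : Matroid α} {S T R : Set α}

theorem isSep_ground (M : Matroid α) : IsSep M M.E := fun _ hC => Or.inl hC.subset_ground

theorem IsSep.compl (h : IsSep M T) : IsSep M (M.E \ T) := fun C hC =>
  (h C hC).symm.imp (fun hd => Set.subset_sdiff.2 ⟨hC.subset_ground, hd⟩)
    fun hs => Set.disjoint_sdiff_right.mono_left hs

theorem IsSep.sInter {𝒯 : Set (Set α)} (h : ∀ T ∈ 𝒯, IsSep M T) : IsSep M (⋂₀ 𝒯) := by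
  intro C hC
  by_cases hd : ∃ T ∈ 𝒯, Disjoint C T
  · obtain ⟨T, hT, hdis⟩ := hd
    exact Or.inr (hdis.mono_right (Set.sInter_subset_of_mem hT))
  · push Not at hd
    exact Or.inl (Set.subset_sInter fun T hT => (h T hT C hC).resolve_right (hd T hT))

theorem IsSep.inter (h : IsSep M S) (h' : IsSep M T) : IsSep M (S ∩ T) := by
  rw [← Set.sInter_pair]
  exact IsSep.sInter (by rintro _ (rfl | rfl) <;> assumption)

theorem IsSep.restrict (h : IsSep M T) (hR : R ⊆ M.E) : IsSep (M.restrict R) T := fun C hC =>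
  h C ((Matroid.restrict_isCircuit_iff hR).1 hC).1

theorem IsSep.of_restrict (hR : R ⊆ M.E) (hs : IsSep M R) (hT : T ⊆ R)
    (h : IsSep (M.restrict R) T) : IsSep M T := fun C hC => by
  rcases hs C hC with hCR | hCR
  · exact h C ((Matroid.restrict_isCircuit_iff hR).2 ⟨hC, hCR⟩)
  · exact Or.inr (hCR.mono_right hT)

theorem disjoint_restrict_ground (M : Matroid α) (T U : Set α) :
    Disjoint (M.restrict T).E (M.restrict (U \ T)).E := Set.disjoint_sdiff_right

/-- A separator splits the matroid into a direct sum. -/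
theorem IsSep.eq_disjointSum (h : IsSep M T) (hT : T ⊆ M.E) {U : Set α} (hU : M.E \ T = U)
    (hd : Disjoint (M.restrict T).E (M.restrict U).E) :
    M = (M.restrict T).disjointSum (M.restrict U) hd := by
  subst hU
  refine Matroid.ext_indep (Matroid.disjointSum_ground_eq.trans (Set.union_sdiff_cancel hT)).symm
    fun I hI => ?_
  simp only [Matroid.disjointSum_indep_iff, Matroid.restrict_indep_iff, Matroid.restrict_ground_eq]
  constructor
  · intro hi
    exact ⟨⟨hi.subset Set.inter_subset_left, Set.inter_subset_right⟩,
      ⟨hi.subset Set.inter_subset_left, Set.inter_subset_right⟩,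
      by rwa [Set.union_sdiff_cancel hT]⟩
  · rintro ⟨⟨h1, -⟩, ⟨h2, -⟩, -⟩
    rw [Matroid.indep_iff_forall_subset_not_isCircuit hI]
    intro C hCI hC
    rcases h C hC with hs | hs
    · exact hC.not_indep (h1.subset (Set.subset_inter hCI hs))
    · exact hC.not_indep (h2.subset
        (Set.subset_inter hCI (Set.subset_sdiff.2 ⟨hC.subset_ground, hs⟩)))

theorem isSep_disjointSum {M₁ M₂ : Matroid α} (hd : Disjoint M₁.E M₂.E) :
    IsSep (M₁.disjointSum M₂ hd) M₁.E := by
  intro C hC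
  by_contra! hn
  obtain ⟨hn1, hn2⟩ := hn
  have hCE : C ⊆ M₁.E ∪ M₂.E := hC.subset_ground.trans_eq Matroid.disjointSum_ground_eq
  have hs1 : C ∩ M₁.E ⊂ C := Set.inter_ssubset_left_iff.2 hn1
  have hs2 : C ∩ M₂.E ⊂ C := by
    refine Set.inter_ssubset_left_iff.2 fun hs => hn2 ?_
    exact (hd.mono_right hs).symm
  have i1 := (Matroid.disjointSum_indep_iff.1 (hC.ssubset_indep hs1)).1
  have i2 := (Matroid.disjointSum_indep_iff.1 (hC.ssubset_indep hs2)).2.1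
  rw [Set.inter_assoc, Set.inter_self] at i1 i2
  exact hC.not_indep (Matroid.disjointSum_indep_iff.2 ⟨i1, i2, hCE⟩)

theorem disjointSum_restrict_left {M₁ M₂ : Matroid α} (hd : Disjoint M₁.E M₂.E) :
    (M₁.disjointSum M₂ hd).restrict M₁.E = M₁ := by
  refine Matroid.ext_indep rfl fun I hI => ?_
  have hI' : I ⊆ M₁.E := hI
  have h2 : I ∩ M₂.E = ∅ := (hd.mono_left hI').inter_eq
  simp [h2, Set.inter_eq_left.2 hI', hI', hI'.trans Set.subset_union_left]

theorem disjointSum_restrict_right {M₁ M₂ : Matroid α} (hd : Disjoint M₁.E M₂.E) :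
    (M₁.disjointSum M₂ hd).restrict M₂.E = M₂ := by
  rw [Matroid.disjointSum_comm]
  exact disjointSum_restrict_left hd.symm

theorem matroidConnected_iff :
    MatroidConnected M ↔ ∀ T ⊆ M.E, IsSep M T → T = ∅ ∨ T = M.E := by
  constructor
  · intro h T hT hsep
    by_contra! hn
    refine h ⟨_, _, disjoint_restrict_ground M T M.E, hn.1, ?_, hsep.eq_disjointSum hT rfl _⟩
    by_contra! he
    exact hn.2 (hT.antisymm (Set.sdiff_eq_empty.1 he))
  · rintro h ⟨M₁, M₂, hd, h1, h2, rfl⟩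
    rcases h _ (Set.subset_union_left.trans_eq Matroid.disjointSum_ground_eq.symm)
      (isSep_disjointSum hd) with e | e
    · exact h1.ne_empty e
    · obtain ⟨x, hx⟩ := h2
      have hx1 : x ∈ M₁.E := by
        rw [e, Matroid.disjointSum_ground_eq]; exact Or.inr hx
      exact hd.le_bot ⟨hx1, hx⟩

theorem isComp_ground_iff (hM : M.E.Nonempty) : IsComp M M.E ↔ MatroidConnected M := by
  rw [matroidConnected_iff]
  exact ⟨fun h => h.minimal, fun h => ⟨subset_rfl, hM, isSep_ground M, h⟩⟩

/-- Every element lies in a component: the intersection of the separators containing it. -/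
theorem exists_isComp {a : α} (ha : a ∈ M.E) : ∃ S, IsComp M S ∧ a ∈ S := by
  let 𝒯 : Set (Set α) := {T | a ∈ T ∧ IsSep M T}
  have haS : a ∈ ⋂₀ 𝒯 := fun T hT => hT.1
  have hS : IsSep M (⋂₀ 𝒯) := IsSep.sInter fun T hT => hT.2
  have hE : ⋂₀ 𝒯 ⊆ M.E := Set.sInter_subset_of_mem ⟨ha, isSep_ground M⟩
  refine ⟨⋂₀ 𝒯, ⟨hE, ⟨a, haS⟩, hS, ?_⟩, haS⟩
  intro T hT hsep
  by_cases haT : a ∈ T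
  · exact Or.inr (hT.antisymm (Set.sInter_subset_of_mem ⟨haT, hsep⟩))
  · left
    have hc : ⋂₀ 𝒯 ⊆ M.E \ T := Set.sInter_subset_of_mem ⟨⟨ha, haT⟩, hsep.compl⟩
    exact Set.eq_empty_of_forall_notMem fun x hx => (hc (hT hx)).2 hx

theorem IsComp.eq_of_mem (h : IsComp M S) (h' : IsComp M T) {a : α} (ha : a ∈ S) (ha' : a ∈ T) :
    S = T := by
  have hi := h.isSep.inter h'.isSep
  have hne : S ∩ T ≠ ∅ := Set.Nonempty.ne_empty ⟨a, ha, ha'⟩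
  rw [← (h.minimal _ Set.inter_subset_left hi).resolve_left hne]
  exact (h'.minimal _ Set.inter_subset_right hi).resolve_left hne

theorem IsComp.restrict (h : IsComp M S) (hR : R ⊆ M.E) (hs : IsSep M R) (hS : S ⊆ R) :
    IsComp (M.restrict R) S :=
  ⟨hS, h.nonempty, h.isSep.restrict hR, fun T hT hsep =>
    h.minimal T hT (IsSep.of_restrict hR hs (hT.trans hS) hsep)⟩

theorem IsComp.of_restrict (hR : R ⊆ M.E) (hs : IsSep M R) (h : IsComp (M.restrict R) S) :
    IsComp M S :=
  ⟨h.subset_ground.trans hR, h.nonempty, IsSep.of_restrict hR hs h.subset_ground h.isSep,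
    fun T hT hsep => h.minimal T hT (hsep.restrict hR)⟩

/-- Circuits on the two sides of a separator may be broken independently of each other. -/
theorem IsSep.indep_union_of_isCircuit (h : IsSep M S) {C C' : Set α} (hC : M.IsCircuit C)
    (hC' : M.IsCircuit C') (hCS : C ⊆ S) (hCS' : Disjoint C' S) {c d : α} (hc : c ∈ C)
    (hd : d ∈ C') : M.Indep ((C \ {c}) ∪ (C' \ {d})) := by
  have hE : (C \ {c}) ∪ (C' \ {d}) ⊆ M.E :=
    Set.union_subset (Set.sdiff_subset.trans hC.subset_ground)
      (Set.sdiff_subset.trans hC'.subset_ground)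
  rw [Matroid.indep_iff_forall_subset_not_isCircuit hE]
  intro D hD hDc
  rcases h D hDc with hs | hs
  · refine hDc.not_indep ((hC.sdiff_singleton_indep hc).subset fun x hx => ?_)
    exact (hD hx).resolve_right fun hx' => hCS'.le_bot ⟨hx'.1, hs hx⟩
  · refine hDc.not_indep ((hC'.sdiff_singleton_indep hd).subset fun x hx => ?_)
    exact (hD hx).resolve_left fun hx' => hs.le_bot ⟨hx, hCS hx'.1⟩

end Separators

/-! ### The gaps of a component are separators -/

/-- The elements of `E` that lie strictly between `s` and the next element of `S`, or all elements
of `E` beyond `s` if `s` is the last element of `S`. -/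
def gap (E S : Finset ℕ) (s : ℕ) : Finset ℕ :=
  {e ∈ E | s < e ∧ ∀ t ∈ S, t ≤ e → t ≤ s}

theorem mem_gap {E S : Finset ℕ} {s e : ℕ} :
    e ∈ gap E S s ↔ e ∈ E ∧ s < e ∧ ∀ t ∈ S, t ≤ e → t ≤ s := by
  simp [gap]

theorem gap_subset (E S : Finset ℕ) (s : ℕ) : gap E S s ⊆ E := Finset.filter_subset _ _

theorem notMem_of_mem_gap {E S : Finset ℕ} {s e : ℕ} (h : e ∈ gap E S s) : e ∉ S := fun he => by
  rw [mem_gap] at h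
  exact absurd (h.2.2 e he le_rfl) (not_le.2 h.2.1)

theorem mul_neg_of_between {b d t : ℕ} (h1 : b < t) (h2 : t < d) :
    ((b : ℝ) - t) * (d - t) < 0 := by
  have h1 : (b : ℝ) < t := by exact_mod_cast h1
  have h2 : (t : ℝ) < d := by exact_mod_cast h2
  nlinarith

/-- In a positroid, the component of the least element partitions the other components among its
gaps: a circuit leaving a gap would separate two parts of the component, and would thus cross a
circuit joining these parts. -/
theorem IsComp.isSep_gap {M : Matroid ℕ} (hM : PosRep M) {E S : Finset ℕ} (hE : M.E = E)
    (hS : IsComp M S) (hinit : ∀ e ∈ E, ∃ t ∈ S, t ≤ e) {s : ℕ} (hs : s ∈ S) :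
    IsSep M (gap E S s) := by
  intro C' hC'
  by_contra! hn
  obtain ⟨hn1, hn2⟩ := hn
  obtain ⟨b, hb, hbG⟩ := Set.not_disjoint_iff.1 hn2
  obtain ⟨d, hd, hdG⟩ := Set.not_subset.1 hn1
  have hbG : b ∈ gap E S s := hbG
  have hdG : d ∉ gap E S s := hdG
  have hbS := notMem_of_mem_gap hbG
  have hdis : Disjoint C' S := (hS.isSep C' hC').resolve_left fun h => hbS (h hb)
  have hdS : d ∉ S := fun h => hdis.le_bot ⟨hd, h⟩
  have hdE : d ∈ E := by
    have := hC'.subset_ground hd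
    rwa [hE] at this
  rw [mem_gap] at hbG
  have hne : ∀ t ∈ S, t ≠ b ∧ t ≠ d := fun t ht =>
    ⟨fun e => hbS (e ▸ ht), fun e => hdS (e ▸ ht)⟩
  obtain ⟨p, hp, q, hq, hpin, hqout⟩ : ∃ p ∈ S, ∃ q ∈ S,
      ((b : ℝ) - p) * (d - p) < 0 ∧ 0 < ((b : ℝ) - q) * (d - q) := by
    by_cases hds : d ≤ s
    · have hds' : d < s := lt_of_le_of_ne hds (hne s hs).2.symm
      obtain ⟨a, ha, had⟩ := hinit d hdE
      have had' : a < d := lt_of_le_of_ne had (hne a ha).2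
      refine ⟨s, hs, a, ha, ?_, ?_⟩
      · rw [mul_comm]; exact mul_neg_of_between hds' hbG.2.1
      · exact mul_pos (sub_pos.2 (by exact_mod_cast had'.trans (hds'.trans hbG.2.1)))
          (sub_pos.2 (by exact_mod_cast had'))
    · have : ¬ ∀ t ∈ S, t ≤ d → t ≤ s := fun h => hdG (mem_gap.2 ⟨hdE, not_le.1 hds, h⟩)
      push Not at this
      obtain ⟨t, ht, htd, hst⟩ := this
      have htd' : t < d := lt_of_le_of_ne htd (hne t ht).2
      have hbt : b < t := by
        by_contra hbt
        exact absurd (hbG.2.2 t ht (not_lt.1 hbt)) (not_le.2 hst)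
      refine ⟨t, ht, s, hs, mul_neg_of_between hbt htd', ?_⟩
      exact mul_pos (sub_pos.2 (by exact_mod_cast hbG.2.1))
        (sub_pos.2 (by exact_mod_cast (not_le.1 hds)))
  let S₁ : Set ℕ := {t ∈ (S : Set ℕ) | ((b : ℝ) - t) * (d - t) < 0}
  have hnot : ¬ IsSep M S₁ := by
    intro h
    rcases hS.minimal S₁ (fun t ht => ht.1) h with e | e
    · exact (e ▸ (show p ∈ S₁ from ⟨hp, hpin⟩) : p ∈ (∅ : Set ℕ))
    · have : q ∈ S₁ := by rw [e]; exact hq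
      exact absurd this.2 (not_lt.2 hqout.le)
  unfold IsSep at hnot
  push Not at hnot
  obtain ⟨C, hC, hC1, hC2⟩ := hnot
  obtain ⟨a, ha, ha1⟩ := Set.not_disjoint_iff.1 hC2
  obtain ⟨c, hc, hc1⟩ := Set.not_subset.1 hC1
  have hCS : C ⊆ S := (hS.isSep C hC).resolve_right fun h => h.le_bot ⟨ha, ha1.1⟩
  have hcS := hCS hc
  have hcpos : 0 < ((b : ℝ) - c) * (d - c) := by
    have h1 : ¬ ((b : ℝ) - c) * (d - c) < 0 := fun h => hc1 ⟨hcS, h⟩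
    refine lt_of_le_of_ne (not_lt.1 h1) (Ne.symm (mul_ne_zero ?_ ?_))
    · exact sub_ne_zero.2 fun e => (hne c hcS).1 (by exact_mod_cast e.symm)
    · exact sub_ne_zero.2 fun e => (hne c hcS).2 (by exact_mod_cast e.symm)
  refine hM.not_crossing hC hC' ha hc hb hd (hdis.symm.mono_left hCS)
    (hS.isSep.indep_union_of_isCircuit hC hC' hCS hdis hc hd) ?_
  have := mul_neg_of_neg_of_pos ha1.2 hcpos
  calc ((b : ℝ) - a) * (b - c) * (d - a) * (d - c) =
      ((b : ℝ) - a) * (d - a) * (((b : ℝ) - c) * (d - c)) := by ring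
    _ < 0 := this

/-- Inserting a positroid into a gap of another one gives a positroid. -/
theorem PosRep.disjointSum_gap {M₁ M₂ : Matroid ℕ} (h₁ : PosRep M₁) (h₂ : PosRep M₂)
    {E S : Finset ℕ} {s : ℕ} (e₁ : M₁.E = ↑(E \ gap E S s)) (e₂ : M₂.E = gap E S s)
    (hd : Disjoint M₁.E M₂.E) : PosRep (M₁.disjointSum M₂ hd) := by
  refine h₁.disjointSum h₂ hd (fun x => if s < x then -1 else 1)
    (fun x => by split_ifs <;> norm_num) ?_
  intro x hx y hy
  rw [e₁, Finset.mem_coe, Finset.mem_sdiff] at hx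
  rw [e₂, Finset.mem_coe, mem_gap] at hy
  split_ifs with hsx
  · have : ¬ ∀ t ∈ S, t ≤ x → t ≤ s := fun h => hx.2 (mem_gap.2 ⟨hx.1, hsx, h⟩)
    push Not at this
    obtain ⟨t, ht, htx, hst⟩ := this
    have hyt : y < t := by
      by_contra hyt
      exact absurd (hy.2.2 t ht (not_lt.1 hyt)) (not_le.2 hst)
    have : (y : ℝ) ≤ x := by exact_mod_cast (hyt.le.trans htx)
    linarith
  · have : (x : ℝ) ≤ y := by exact_mod_cast ((not_lt.1 hsx).trans hy.2.1.le)
    linarith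

/-! ### Transport between positroids on `Fin n` and on finite sets of natural numbers -/

theorem linearIndepOn_image_iff {α β V : Type*} [AddCommGroup V] [Module ℝ V] {f : α → β}
    (hf : f.Injective) {v : β → V} {K : Set α} :
    LinearIndepOn ℝ v (f '' K) ↔ LinearIndepOn ℝ (v ∘ f) K :=
  (linearIndependent_equiv' (Equiv.Set.image f K hf) (g := fun x : K => v (f x))
    (f := fun y : f '' K => v y) rfl).symm

/-- The matroid of a matrix of full rank may be described by its independent sets. -/
theorem isMatroidOf_iff_indep {d n : ℕ} {M : Matroid (Fin n)} {A : Matrix (Fin d) (Fin n) ℝ}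
    (hA : Submodule.span ℝ (Set.range A.col) = ⊤) :
    IsMatroidOf M A ↔ M.E = Set.univ ∧ ∀ I, M.Indep I ↔ LinearIndepOn ℝ A.col I := by
  have hext : ∀ I, LinearIndepOn ℝ A.col I → ∃ B, I ⊆ B ∧ LinearIndepOn ℝ A.col B ∧
      Submodule.span ℝ (A.col '' B) = ⊤ := by
    intro I hI
    obtain ⟨B, -, hIB, hsp, hB⟩ := exists_linearIndepOn_extension hI (Set.subset_univ _)
    refine ⟨B, hIB, hB, ?_⟩
    rw [eq_top_iff, ← hA, ← Set.image_univ]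
    exact Submodule.span_le.2 hsp
  refine and_congr_right fun hE => ⟨fun h I => ?_, fun h B => ?_⟩
  · constructor
    · intro hI
      obtain ⟨B, hB, hIB⟩ := hI.exists_isBase_superset
      exact ((h B).1 hB).1.mono hIB
    · intro hI
      obtain ⟨B, hIB, hB⟩ := hext I hI
      exact ((h B).2 hB).indep.subset hIB
  · constructor
    · intro hB
      have hi := (h B).1 hB.indep
      obtain ⟨B', hBB', hi', hsp⟩ := hext B hi
      rw [hB.eq_of_subset_indep ((h B').2 hi') hBB']
      exact ⟨hi', hsp⟩
    · rintro ⟨hi, hsp⟩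
      refine ((h B).2 hi).isBase_of_forall_insert fun x hx hins => ?_
      have := (h _).1 hins
      rw [linearIndepOn_insert hx.2, hsp] at this
      exact this.2 Submodule.mem_top

theorem rank_eq_iff_span {d n : ℕ} (A : Matrix (Fin d) (Fin n) ℝ) :
    A.rank = d ↔ Submodule.span ℝ (Set.range A.col) = ⊤ := by
  rw [rank_eq_finrank_span_cols]
  constructor
  · intro h
    exact Submodule.eq_top_of_finrank_eq (by simpa using h)
  · intro h
    rw [h]; simp

/-- The signs of the maximal minors of a representation may be made positive, by reflecting a
coordinate if necessary. -/
theorem PosRep.exists_pos {M : Matroid ℕ} (h : PosRep M) :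
    ∃ (d : ℕ) (v : ℕ → Fin d → ℝ), IsPosRep M v 1 := by
  obtain ⟨d, v, c, h⟩ := h
  have key : ∀ {v : ℕ → Fin d → ℝ} {c : ℝ}, IsPosRep M v c → 0 < c → IsPosRep M v 1 :=
    fun h hc => ⟨one_ne_zero, h.indep_iff, h.span_eq, fun g => by
      rw [one_mul]; exact nonneg_of_mul_nonneg_right (h.nonneg g) hc⟩
  rcases lt_or_gt_of_ne h.ne_zero with hc | hc
  · rcases Nat.eq_zero_or_pos d with rfl | hd
    · have := h.nonneg Fin.elim0
      simp [normMinor, vdm] at this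
      exact absurd this (not_le.2 hc)
    -- for `d = 0` the only minor is `1`, so `c` is positive; otherwise reflect the first coordinate
    · let f : (Fin d → ℝ) →ₗ[ℝ] (Fin d → ℝ) :=
        toLin' (diagonal (Function.update 1 ⟨0, hd⟩ (-1)))
      have hf : LinearMap.det f = -1 := by
        rw [LinearMap.det_toLin', det_diagonal, Finset.prod_update_of_mem (Finset.mem_univ _)]
        simp
      have hf0 : LinearMap.det f ≠ 0 := by rw [hf]; norm_num
      have h' := h.map_linearEquiv (LinearMap.equivOfDetNeZero f hf0)
      have e : (LinearMap.equivOfDetNeZero f hf0 : (Fin d → ℝ) →ₗ[ℝ] (Fin d → ℝ)) = f := by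
        ext; rfl
      have hpos : 0 < c * LinearMap.det (LinearMap.equivOfDetNeZero f hf0 :
          (Fin d → ℝ) →ₗ[ℝ] (Fin d → ℝ)) := by
        rw [e, hf]; linarith
      exact ⟨d, _, key h' hpos⟩
  · exact ⟨d, v, key h hc⟩

section Transport

variable {n : ℕ} {f : Fin n → ℕ}

theorem IsPositroid.ground_eq {M : Matroid (Fin n)} (h : IsPositroid M) : M.E = Set.univ := by
  obtain ⟨d, A, -, hM⟩ := h
  exact hM.1

theorem IsPositroid.posRep_map {M : Matroid (Fin n)} (h : IsPositroid M) (hf : StrictMono f) :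
    PosRep (M.map f hf.injective.injOn) := by
  obtain ⟨d, A, ⟨hr, hA⟩, hM⟩ := h
  have hsp := (rank_eq_iff_span A).1 hr
  obtain ⟨hE, hI⟩ := (isMatroidOf_iff_indep hsp).1 hM
  let v : ℕ → Fin d → ℝ := Function.extend f A.col (0 : ℕ → Fin d → ℝ)
  have hvf : v ∘ f = A.col := by
    ext i : 1
    exact hf.injective.extend_apply A.col (0 : ℕ → Fin d → ℝ) i
  have hv0 : ∀ x : ℕ, x ∉ Set.range f → v x = 0 := fun x hx =>
    Function.extend_apply' A.col (0 : ℕ → Fin d → ℝ) x hx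
  refine ⟨d, v, 1, one_ne_zero, ?_, ?_, ?_⟩
  · intro I
    rw [Matroid.map_indep_iff]
    constructor
    · rintro ⟨K, hK, rfl⟩
      rw [linearIndepOn_image_iff hf.injective, hvf]
      exact (hI K).1 hK
    · intro h
      have hsub : I ⊆ Set.range f := fun x hx => by
        by_contra hxf
        exact h.ne_zero hx (hv0 x hxf)
      obtain ⟨K, rfl⟩ := Set.subset_range_iff_exists_image_eq.1 hsub
      rw [linearIndepOn_image_iff hf.injective, hvf] at h
      exact ⟨K, (hI K).2 h, rfl⟩
  · rw [eq_top_iff, ← hsp, ← hvf]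
    exact Submodule.span_mono (Set.range_comp_subset_range f v)
  · intro g
    rw [one_mul]
    by_cases hdet : (of fun i => v (g i)).det = 0
    · simp [normMinor, hdet]
    have hinj := injective_of_det_ne_zero hdet
    have hmem : ∀ i, ∃ k, f k = g i := fun i => by
      by_contra hn
      exact hdet (det_eq_zero_of_row_eq_zero i fun a => by simp [hv0 _ hn])
    choose g' hg' using hmem
    have hg'inj : g'.Injective := fun i j hij => hinj (by rw [← hg', ← hg', hij])
    have hcard : (Finset.univ.image g').card = d := by
      rw [Finset.card_image_of_injective _ hg'inj, Finset.card_univ, Fintype.card_fin]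
    let o := (Finset.univ.image g').orderEmbOfFin hcard
    have hgo : g = f ∘ g' := by ext i; exact (hg' i).symm
    rw [normMinor_eq_of_range_eq v hinj (h := f ∘ o) (hf.injective.comp o.injective)
      (by rw [hgo, Set.range_comp, Set.range_comp]; simp [o])]
    refine mul_nonneg ?_ (vdm_pos (hf.comp o.strictMono)).le
    have := hA o
    rw [← det_transpose] at this
    have e : (of fun i => v ((f ∘ o) i)) = (A.submatrix id o)ᵀ := by
      ext i j
      exact congrFun (congrFun hvf (o i)) j
    rw [e]
    exact this

theorem PosRep.isPositroid_comap {N : Matroid ℕ} (h : PosRep N) (hf : StrictMono f)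
    (hN : N.E = Set.range f) : IsPositroid (N.comap f) := by
  obtain ⟨d, v, h⟩ := h.exists_pos
  let A : Matrix (Fin d) (Fin n) ℝ := of fun i j => v (f j) i
  have hcol : A.col = v ∘ f := rfl
  have hsp : Submodule.span ℝ (Set.range A.col) = ⊤ := by
    rw [eq_top_iff, ← h.span_eq, Submodule.span_le]
    rintro _ ⟨x, rfl⟩
    by_cases hx : x ∈ Set.range f
    · obtain ⟨i, rfl⟩ := hx
      exact Submodule.subset_span ⟨i, rfl⟩
    · rw [h.eq_zero (hN ▸ hx)]
      exact zero_mem _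
  refine ⟨d, A, ⟨(rank_eq_iff_span A).2 hsp, fun o => ?_⟩, (isMatroidOf_iff_indep hsp).2 ⟨?_, ?_⟩⟩
  · have := h.nonneg (f ∘ o)
    rw [one_mul, normMinor] at this
    have := nonneg_of_mul_nonneg_left this (vdm_pos (hf.comp o.strictMono))
    rw [← det_transpose]
    exact this
  · rw [Matroid.comap_ground_eq, hN, Set.preimage_range]
  · intro I
    rw [Matroid.comap_indep_iff, h.indep_iff, linearIndepOn_image_iff hf.injective, hcol,
      and_iff_left hf.injective.injOn]

theorem map_isCircuit_iff {α β : Type*} {M : Matroid α} {f : α → β} (hf : f.Injective)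
    {C : Set β} : (M.map f hf.injOn).IsCircuit C ↔ ∃ C₀, M.IsCircuit C₀ ∧ C = f '' C₀ := by
  simp only [Matroid.isCircuit_iff, Matroid.map_dep_iff]
  constructor
  · rintro ⟨⟨C₀, hC₀, rfl⟩, h⟩
    exact ⟨C₀, ⟨hC₀, fun D hD hDC =>
      hf.image_injective (h ⟨D, hD, rfl⟩ (Set.image_mono hDC))⟩, rfl⟩
  · rintro ⟨C₀, ⟨hC₀, h⟩, rfl⟩
    refine ⟨⟨C₀, hC₀, rfl⟩, ?_⟩
    rintro _ ⟨D, hD, rfl⟩ hDC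
    rw [h hD ((Set.image_subset_image_iff hf).1 hDC)]

theorem isSep_map_iff {α β : Type*} {M : Matroid α} {f : α → β} (hf : f.Injective)
    {T : Set α} : IsSep (M.map f hf.injOn) (f '' T) ↔ IsSep M T := by
  simp only [IsSep, map_isCircuit_iff hf]
  constructor
  · intro h C hC
    have := h _ ⟨C, hC, rfl⟩
    rwa [Set.image_subset_image_iff hf, Set.disjoint_image_iff hf] at this
  · rintro h _ ⟨C, hC, rfl⟩
    rw [Set.image_subset_image_iff hf, Set.disjoint_image_iff hf]
    exact h C hC

theorem matroidConnected_map_iff {α β : Type*} {M : Matroid α} {f : α → β} (hf : f.Injective) :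
    MatroidConnected (M.map f hf.injOn) ↔ MatroidConnected M := by
  simp only [matroidConnected_iff, Matroid.map_ground]
  constructor
  · intro h T hT hsep
    have := h _ (Set.image_mono hT) ((isSep_map_iff hf).2 hsep)
    rwa [Set.image_eq_empty, hf.image_injective.eq_iff] at this
  · intro h T hT hsep
    obtain ⟨T, hT', rfl⟩ := Set.subset_image_iff.1 hT
    rw [Set.image_eq_empty, hf.image_injective.eq_iff]
    exact h T hT' ((isSep_map_iff hf).1 hsep)

end Transport

/-- Positroids on `Fin n` correspond to positroids on any set of `n` natural numbers. -/
noncomputable def positroidEquiv {n : ℕ} (E : Finset ℕ) (hE : E.card = n) :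
    {M : Matroid (Fin n) // IsPositroid M} ≃ {N : Matroid ℕ // N.E = E ∧ PosRep N} where
  toFun M := ⟨M.1.map (E.orderEmbOfFin hE) (E.orderEmbOfFin hE).injective.injOn, by
    rw [Matroid.map_ground, M.2.ground_eq, Set.image_univ, Finset.range_orderEmbOfFin],
    M.2.posRep_map (E.orderEmbOfFin hE).strictMono⟩
  invFun N := ⟨N.1.comap (E.orderEmbOfFin hE),
    N.2.2.isPositroid_comap (E.orderEmbOfFin hE).strictMono
      (by rw [N.2.1, Finset.range_orderEmbOfFin])⟩
  left_inv M := Subtype.ext (Matroid.comap_map (E.orderEmbOfFin hE).injective)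
  right_inv N := Subtype.ext (Matroid.map_comap
    (by rw [N.2.1, Finset.range_orderEmbOfFin]) (E.orderEmbOfFin hE).injective.injOn)

theorem card_posRep_eq (E : Finset ℕ) :
    Nat.card {N : Matroid ℕ // N.E = E ∧ PosRep N} = numPositroids E.card :=
  (Nat.card_congr (positroidEquiv E rfl)).symm

theorem card_connected_posRep_eq (E : Finset ℕ) :
    Nat.card {N : Matroid ℕ // (N.E = E ∧ PosRep N) ∧ MatroidConnected N} =
      numConnectedPositroids E.card := by
  refine (Nat.card_congr ?_).symm
  refine (Equiv.subtypeSubtypeEquivSubtypeInter _ _).symm.trans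
    (Equiv.trans ?_ (Equiv.subtypeSubtypeEquivSubtypeInter _ _))
  exact (positroidEquiv E rfl).subtypeEquiv fun M =>
    (matroidConnected_map_iff (E.orderEmbOfFin rfl).injective).symm

/-! ### Counting positroids by the component of the least element -/

/-- The number of positroids on `E` that have `S` as a component. -/
noncomputable def numWithComp (S E : Finset ℕ) : ℕ :=
  Nat.card {N : Matroid ℕ // (N.E = E ∧ PosRep N) ∧ IsComp N S}

theorem finite_matroid_ground (E : Finset ℕ) : Finite {N : Matroid ℕ // N.E = E} := by
  refine Finite.of_injective (β := Set (Set E))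
    (fun N => {I | N.1.Indep (Subtype.val '' I)}) ?_
  rintro ⟨N, hN⟩ ⟨N', hN'⟩ h
  refine Subtype.ext (Matroid.ext_indep (hN.trans hN'.symm) fun I hI => ?_)
  have hIE : I ⊆ Set.range (Subtype.val : E → ℕ) := by
    rw [hN] at hI; simpa using hI
  obtain ⟨K, rfl⟩ := Set.subset_range_iff_exists_image_eq.1 hIE
  exact Set.ext_iff.1 h K

theorem finite_matroid_subtype (E : Finset ℕ) (p : Matroid ℕ → Prop) (hp : ∀ N, p N → N.E = E) :
    Finite {N : Matroid ℕ // p N} :=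
  have := finite_matroid_ground E
  Finite.of_injective (fun N : {N : Matroid ℕ // p N} =>
    (⟨N.1, hp N.1 N.2⟩ : {N : Matroid ℕ // N.E = E})) fun _ _ h =>
      Subtype.ext (congrArg (fun N => N.1) h)

theorem numPositroids_eq_sum {E : Finset ℕ} {a : ℕ} (ha : a ∈ E) :
    numPositroids E.card = ∑ S ∈ E.powerset with a ∈ S, numWithComp S E := by
  rw [← card_posRep_eq, ← Finset.sum_coe_sort]
  have hfin : ∀ S : {S // S ∈ E.powerset.filter (a ∈ ·)},
      Finite {N : Matroid ℕ // (N.E = E ∧ PosRep N) ∧ IsComp N (S : Finset ℕ)} :=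
    fun S => finite_matroid_subtype E _ fun N hN => hN.1.1
  simp only [numWithComp]
  rw [← Nat.card_sigma]
  have hmem : ∀ S : {S // S ∈ E.powerset.filter (a ∈ ·)}, a ∈ S.1 := fun S =>
    (Finset.mem_filter.1 S.2).2
  refine (Nat.card_congr (Equiv.ofBijective (fun x : Σ S : {S // S ∈ E.powerset.filter (a ∈ ·)},
    {N : Matroid ℕ // (N.E = E ∧ PosRep N) ∧ IsComp N (S : Finset ℕ)} =>
      (⟨x.2.1, x.2.2.1⟩ : {N : Matroid ℕ // N.E = E ∧ PosRep N})) ⟨?_, ?_⟩)).symm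
  · rintro ⟨S, N, hN, hS⟩ ⟨S', N', hN', hS'⟩ h
    obtain rfl : N = N' := congrArg (fun N => N.1) h
    obtain rfl : S = S' := Subtype.ext (Finset.coe_injective
      (hS.eq_of_mem hS' (a := a) (hmem S) (hmem S')))
    rfl
  · rintro ⟨N, hN⟩
    obtain ⟨S, hS, haS⟩ := exists_isComp (M := N) (a := a) (by rw [hN.1]; exact ha)
    have hSE : S ⊆ E := hS.subset_ground.trans_eq hN.1
    lift S to Finset ℕ using E.finite_toSet.subset hSE
    exact ⟨⟨⟨S, Finset.mem_filter.2 ⟨Finset.mem_powerset.2 (by exact_mod_cast hSE), haS⟩⟩,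
      ⟨N, hN, hS⟩⟩, rfl⟩

/-- A gap of the component contributes an independent positroid. -/
theorem numWithComp_eq_mul_gap {E S : Finset ℕ} (hSE : S ⊆ E)
    (hinit : ∀ e ∈ E, ∃ t ∈ S, t ≤ e) {s : ℕ} (hs : s ∈ S) :
    numWithComp S E = numWithComp S (E \ gap E S s) * numPositroids (gap E S s).card := by
  rw [← card_posRep_eq, numWithComp, numWithComp, ← Nat.card_prod]
  set G := gap E S s with hG
  have hGE : (G : Set ℕ) ⊆ E := by exact_mod_cast gap_subset E S s
  have hdisj : Disjoint ((E \ G : Finset ℕ) : Set ℕ) G := by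
    exact_mod_cast Finset.sdiff_disjoint
  have hunion : ((E \ G : Finset ℕ) : Set ℕ) ∪ G = E := by
    rw [Finset.coe_sdiff, Set.sdiff_union_of_subset hGE]
  have hsub : ((E \ G : Finset ℕ) : Set ℕ) ⊆ E := by exact_mod_cast Finset.sdiff_subset
  have hSG : (S : Set ℕ) ⊆ ((E \ G : Finset ℕ) : Set ℕ) := by
    exact_mod_cast fun x hx => Finset.mem_sdiff.2 ⟨hSE hx, fun h => notMem_of_mem_gap h hx⟩
  have hsep : ∀ N : {N : Matroid ℕ // (N.E = E ∧ PosRep N) ∧ IsComp N (S : Set ℕ)},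
      IsSep N.1 ((E \ G : Finset ℕ) : Set ℕ) := fun N => by
    have := (N.2.2.isSep_gap N.2.1.2 N.2.1.1 hinit hs).compl
    rwa [N.2.1.1, ← Finset.coe_sdiff] at this
  refine Nat.card_congr ⟨fun N =>
    (⟨N.1.restrict ((E \ G : Finset ℕ) : Set ℕ), ⟨rfl, N.2.1.2.restrict _⟩,
      N.2.2.restrict (hsub.trans_eq N.2.1.1.symm) (hsep N) hSG⟩,
     ⟨N.1.restrict (G : Set ℕ), rfl, N.2.1.2.restrict _⟩),
    fun N => ⟨N.1.1.disjointSum N.2.1 (by rw [N.1.2.1.1, N.2.2.1]; exact hdisj),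
      ⟨by rw [Matroid.disjointSum_ground_eq, N.1.2.1.1, N.2.2.1, hunion],
        N.1.2.1.2.disjointSum_gap N.2.2.2 N.1.2.1.1 N.2.2.1 _⟩, ?_⟩, ?_, ?_⟩
  · have hd : Disjoint N.1.1.E N.2.1.E := by rw [N.1.2.1.1, N.2.2.1]; exact hdisj
    refine IsComp.of_restrict (R := N.1.1.E) ?_ (isSep_disjointSum hd) ?_
    · exact Set.subset_union_left.trans_eq Matroid.disjointSum_ground_eq.symm
    · rw [disjointSum_restrict_left]
      exact N.1.2.2
  · intro N
    apply Subtype.ext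
    refine ((hsep N).eq_disjointSum (hsub.trans_eq N.2.1.1.symm) (U := G) ?_ _).symm
    rw [N.2.1.1, Finset.coe_sdiff, Set.sdiff_sdiff_cancel_left hGE]
  · rintro ⟨⟨N₁, ⟨e₁, h₁⟩, hS⟩, ⟨N₂, e₂, h₂⟩⟩
    have hd : Disjoint N₁.E N₂.E := by rw [e₁, e₂]; exact hdisj
    refine Prod.ext (Subtype.ext ?_) (Subtype.ext ?_)
    · change (N₁.disjointSum N₂ hd).restrict _ = N₁
      rw [← e₁]
      exact disjointSum_restrict_left hd
    · change (N₁.disjointSum N₂ hd).restrict _ = N₂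
      rw [← e₂]
      exact disjointSum_restrict_right hd

theorem disjoint_gap {E S : Finset ℕ} {s t : ℕ} (hs : s ∈ S) (ht : t ∈ S) (hst : s ≠ t) :
    Disjoint (gap E S s) (gap E S t) := by
  rw [Finset.disjoint_left]
  intro e h1 h2
  rw [mem_gap] at h1 h2
  exact hst (le_antisymm (h2.2.2 s hs h1.2.1.le) (h1.2.2 t ht h2.2.1.le))

theorem sdiff_biUnion_gap {E S : Finset ℕ} (hSE : S ⊆ E) (hinit : ∀ e ∈ E, ∃ t ∈ S, t ≤ e) :
    E \ S.biUnion (gap E S) = S := by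
  ext e
  simp only [Finset.mem_sdiff, Finset.mem_biUnion, not_exists, not_and]
  constructor
  · rintro ⟨heE, he⟩
    by_contra heS
    obtain ⟨t, ht, hte⟩ := hinit e heE
    have hne : (S.filter (· ≤ e)).Nonempty := ⟨t, Finset.mem_filter.2 ⟨ht, hte⟩⟩
    have hm := Finset.max'_mem _ hne
    rw [Finset.mem_filter] at hm
    refine he _ hm.1 (mem_gap.2 ⟨heE, lt_of_le_of_ne hm.2 fun h => heS (h ▸ hm.1), ?_⟩)
    intro u hu hue
    exact Finset.le_max' _ _ (Finset.mem_filter.2 ⟨hu, hue⟩)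
  · intro he
    exact ⟨hSE he, fun s _ h => notMem_of_mem_gap h he⟩

/-- Several gaps of the component may be removed at once. -/
theorem numWithComp_eq_mul_prod {E S : Finset ℕ} (hSE : S ⊆ E)
    (hinit : ∀ e ∈ E, ∃ t ∈ S, t ≤ e) {T : Finset ℕ} (hT : T ⊆ S) :
    numWithComp S E = numWithComp S (E \ T.biUnion (gap E S)) *
      ∏ s ∈ T, numPositroids (gap E S s).card := by
  induction T using Finset.induction_on with
  | empty => simp
  | insert s T hs ih =>
    have hsS : s ∈ S := hT (Finset.mem_insert_self s T)
    have hTS : T ⊆ S := (Finset.subset_insert s T).trans hT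
    rw [ih hTS]
    set E' := E \ T.biUnion (gap E S) with hE'
    have hSE' : S ⊆ E' := fun x hx => Finset.mem_sdiff.2 ⟨hSE hx, fun h => by
      obtain ⟨t, _, hxt⟩ := Finset.mem_biUnion.1 h
      exact notMem_of_mem_gap hxt hx⟩
    have hgap : gap E' S s = gap E S s := by
      ext e
      rw [mem_gap, mem_gap, hE', Finset.mem_sdiff]
      refine ⟨fun h => ⟨h.1.1, h.2⟩, fun h => ⟨⟨h.1, fun hu => ?_⟩, h.2⟩⟩
      obtain ⟨t, ht, het⟩ := Finset.mem_biUnion.1 hu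
      have hst : s ≠ t := fun e => hs (e ▸ ht)
      exact Finset.disjoint_left.1 (disjoint_gap hsS (hTS ht) hst) (mem_gap.2 h) het
    rw [numWithComp_eq_mul_gap hSE' (fun e he => hinit e (Finset.mem_sdiff.1 he).1) hsS, hgap,
      Finset.prod_insert hs, Finset.biUnion_insert, hE', Finset.sdiff_sdiff_left', ← mul_assoc]
    congr 2
    rw [← Finset.sdiff_union_distrib, Finset.union_comm]

/-- Removing all gaps leaves a connected positroid on the component. -/
theorem numWithComp_eq {E S : Finset ℕ} (hSE : S ⊆ E) (hinit : ∀ e ∈ E, ∃ t ∈ S, t ≤ e)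
    (hS : S.Nonempty) :
    numWithComp S E = numConnectedPositroids S.card *
      ∏ s ∈ S, numPositroids (gap E S s).card := by
  rw [numWithComp_eq_mul_prod hSE hinit subset_rfl, sdiff_biUnion_gap hSE hinit,
    ← card_connected_posRep_eq, numWithComp]
  congr 1
  refine Nat.card_congr (Equiv.subtypeEquivRight fun N => and_congr_right fun hN => ?_)
  rw [← hN.1, isComp_ground_iff]
  rw [hN.1]
  exact hS

/-! ### The generating function -/

theorem numPositroids_zero : numPositroids 0 = 1 := by
  have hpos : IsPositroid (Matroid.emptyOn (Fin 0)) := by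
    refine ⟨0, 0, ⟨by simp, fun f => by simp⟩, Set.eq_univ_of_forall fun i => i.elim0, fun B => ?_⟩
    obtain rfl : B = ∅ := Set.eq_empty_of_forall_notMem fun i => i.elim0
    simpa using Subsingleton.elim _ _
  rw [numPositroids, Nat.card_eq_one_iff_unique]
  refine ⟨⟨fun M N => Subtype.ext ?_⟩, ⟨⟨_, hpos⟩⟩⟩
  rw [M.1.eq_emptyOn, N.1.eq_emptyOn]

/-- The sets of `k` numbers below `n` that contain the least number below `n`, if there is one. -/
def initialSets (n k : ℕ) : Finset (Finset ℕ) :=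
  {S ∈ (Finset.range n).powerset | (∀ e ∈ Finset.range n, ∃ t ∈ S, t ≤ e) ∧ S.card = k}

theorem mem_initialSets {n k : ℕ} {S : Finset ℕ} :
    S ∈ initialSets n k ↔ S ⊆ Finset.range n ∧ (∀ e < n, ∃ t ∈ S, t ≤ e) ∧ S.card = k := by
  simp [initialSets]

theorem gap_insert_last {n m : ℕ} {S : Finset ℕ} (hS : S ⊆ Finset.range m) :
    (gap (Finset.range n) (insert m S) m).card = n - m - 1 := by
  have : gap (Finset.range n) (insert m S) m = Finset.Ioo m n := by
    ext e
    simp only [mem_gap, Finset.mem_range, Finset.mem_insert, Finset.mem_Ioo]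
    refine ⟨fun h => ⟨h.2.1, h.1⟩, fun h => ⟨h.2, h.1, ?_⟩⟩
    rintro t (rfl | ht) -
    · exact le_rfl
    · exact (Finset.mem_range.1 (hS ht)).le
  rw [this, Nat.card_Ioo]

theorem gap_insert_of_mem {n m : ℕ} (hm : m < n) {S : Finset ℕ} (hS : S ⊆ Finset.range m)
    {s : ℕ} (hs : s ∈ S) :
    gap (Finset.range n) (insert m S) s = gap (Finset.range m) S s := by
  have hsm := Finset.mem_range.1 (hS hs)
  ext e
  simp only [mem_gap, Finset.mem_range, Finset.mem_insert]
  constructor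
  · rintro ⟨-, h2, h3⟩
    refine ⟨?_, h2, fun t ht => h3 t (Or.inr ht)⟩
    by_contra hem
    exact absurd (h3 m (Or.inl rfl) (not_lt.1 hem)) (not_le.2 hsm)
  · rintro ⟨h1, h2, h3⟩
    refine ⟨h1.trans hm, h2, ?_⟩
    rintro t (rfl | ht) hte
    · omega
    · exact h3 t ht hte

/-- Removing the last element of a set identifies sums over `initialSets`. -/
theorem sum_initialSets_succ (a : ℕ → ℚ) (n k : ℕ) :
    ∑ S ∈ initialSets n (k + 1), ∏ s ∈ S, a (gap (Finset.range n) S s).card =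
      ∑ m ∈ Finset.range n, (∑ S ∈ initialSets m k,
        ∏ s ∈ S, a (gap (Finset.range m) S s).card) * a (n - m - 1) := by
  simp_rw [Finset.sum_mul]
  rw [Finset.sum_sigma']
  symm
  have hsup : ∀ {m : ℕ} {S : Finset ℕ}, S ⊆ Finset.range m → (insert m S).sup id = m := by
    intro m S hS
    rw [Finset.sup_insert]
    exact sup_eq_left.2 (Finset.sup_le fun t ht => (Finset.mem_range.1 (hS ht)).le)
  refine Finset.sum_nbij' (fun x => insert x.1 x.2) (fun S => ⟨S.sup id, S.erase (S.sup id)⟩)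
    ?_ ?_ ?_ ?_ ?_
  · rintro ⟨m, S⟩ hx
    rw [Finset.mem_sigma, Finset.mem_range, mem_initialSets] at hx
    obtain ⟨hm, hS, hi, hc⟩ := hx
    have hmS : m ∉ S := fun h => absurd (Finset.mem_range.1 (hS h)) (lt_irrefl _)
    refine mem_initialSets.2 ⟨?_, ?_, ?_⟩
    · exact Finset.insert_subset (Finset.mem_range.2 hm)
        (hS.trans (Finset.range_subset_range.2 hm.le))
    · intro e he
      by_cases hem : e < m
      · obtain ⟨t, ht, hte⟩ := hi e hem
        exact ⟨t, Finset.mem_insert_of_mem ht, hte⟩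
      · exact ⟨m, Finset.mem_insert_self _ _, not_lt.1 hem⟩
    · rw [Finset.card_insert_of_notMem hmS, hc]
  · intro S hS
    obtain ⟨hSn, hi, hc⟩ := mem_initialSets.1 hS
    have hne : S.Nonempty := Finset.card_pos.1 (by omega)
    obtain ⟨m, hm, hmax⟩ := Finset.exists_mem_eq_sup S hne id
    have hmax : S.sup id = m := hmax
    have hle : ∀ t ∈ S, t ≤ m := fun t ht => hmax ▸ Finset.le_sup (f := id) ht
    have hmn := Finset.mem_range.1 (hSn hm)
    simp only [hmax, Finset.mem_sigma, Finset.mem_range, mem_initialSets]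
    refine ⟨hmn, fun t ht => ?_, fun e he => ?_, ?_⟩
    · rw [Finset.mem_erase] at ht
      exact Finset.mem_range.2 (lt_of_le_of_ne (hle t ht.2) ht.1)
    · obtain ⟨t, ht, hte⟩ := hi e (he.trans hmn)
      exact ⟨t, Finset.mem_erase.2 ⟨by omega, ht⟩, hte⟩
    · rw [Finset.card_erase_of_mem hm, hc, Nat.add_sub_cancel]
  · rintro ⟨m, S⟩ hx
    rw [Finset.mem_sigma, Finset.mem_range, mem_initialSets] at hx
    obtain ⟨hm, hS, hi, hc⟩ := hx
    have hmS : m ∉ S := fun h => absurd (Finset.mem_range.1 (hS h)) (lt_irrefl _)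
    simp only [hsup hS, Finset.erase_insert hmS]
  · intro S hS
    obtain ⟨hSn, hi, hc⟩ := mem_initialSets.1 hS
    have hne : S.Nonempty := Finset.card_pos.1 (by omega)
    obtain ⟨m, hm, hmax⟩ := Finset.exists_mem_eq_sup S hne id
    have hmax : S.sup id = m := hmax
    simp only [hmax, Finset.insert_erase hm]
  · rintro ⟨m, S⟩ hx
    rw [Finset.mem_sigma, Finset.mem_range, mem_initialSets] at hx
    obtain ⟨hm, hS, hi, hc⟩ := hx
    have hmS : m ∉ S := fun h => absurd (Finset.mem_range.1 (hS h)) (lt_irrefl _)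
    simp only
    rw [Finset.prod_insert hmS, gap_insert_last hS, mul_comm]
    congr 1
    exact Finset.prod_congr rfl fun s hs => by rw [gap_insert_of_mem hm hS hs]

/-- The sets of size `k` weighted by their gaps are counted by the `k`-th power of `x a(x)`: each
element is followed by its gap. -/
theorem sum_initialSets_eq_coeff (a : ℕ → ℚ) (k n : ℕ) :
    ∑ S ∈ initialSets n k, ∏ s ∈ S, a (gap (Finset.range n) S s).card =
      PowerSeries.coeff n ((PowerSeries.X * PowerSeries.mk a) ^ k) := by
  induction k generalizing n with
  | zero =>
    rw [pow_zero, PowerSeries.coeff_one]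
    rcases Nat.eq_zero_or_pos n with rfl | hn
    · have : initialSets 0 0 = {∅} := by
        ext S; simp +contextual [mem_initialSets]
      simp [this]
    · have : initialSets n 0 = ∅ := by
        refine Finset.eq_empty_of_forall_notMem fun S hS => ?_
        obtain ⟨-, hi, hc⟩ := mem_initialSets.1 hS
        obtain ⟨t, ht, -⟩ := hi 0 hn
        rw [Finset.card_eq_zero.1 hc] at ht
        exact Finset.notMem_empty _ ht
      simp [this, hn.ne']
  | succ k ih =>
    rw [sum_initialSets_succ, pow_succ, PowerSeries.coeff_mul,
      Finset.Nat.sum_antidiagonal_eq_sum_range_succ (fun i j =>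
        PowerSeries.coeff i ((PowerSeries.X * PowerSeries.mk a) ^ k) *
          PowerSeries.coeff j (PowerSeries.X * PowerSeries.mk a)), Finset.sum_range_succ]
    have h0 : PowerSeries.coeff (n - n) (PowerSeries.X * PowerSeries.mk a) = 0 := by simp
    rw [h0, mul_zero, add_zero]
    refine Finset.sum_congr rfl fun m hm => ?_
    rw [Finset.mem_range] at hm
    rw [ih, show n - m = (n - m - 1) + 1 by omega, PowerSeries.coeff_succ_X_mul,
      PowerSeries.coeff_mk, Nat.add_sub_cancel]

/-- The convention `P(0) = 1` agrees with the count of positroids on the empty set. -/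
theorem positroidSeries_eq_mk :
    positroidSeries = PowerSeries.mk fun n => (numPositroids n : ℚ) := by
  ext n
  rw [positroidSeries, PowerSeries.coeff_mk, PowerSeries.coeff_mk]
  split_ifs with h
  · rw [h, numPositroids_zero, Nat.cast_one]
  · rfl

/-- Decomposition of the positroids on `n ≥ 1` elements by the size of the component of the least
element. -/
theorem numPositroids_eq_sum_coeff {n : ℕ} (hn : 0 < n) :
    (numPositroids n : ℚ) = ∑ k ∈ Finset.range (n + 1), (numConnectedPositroids k : ℚ) *
      PowerSeries.coeff n ((PowerSeries.X * positroidSeries) ^ k) := by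
  have h := numPositroids_eq_sum (E := Finset.range n) (Finset.mem_range.2 hn)
  rw [Finset.card_range] at h
  rw [h, Nat.cast_sum]
  rw [← Finset.sum_fiberwise_of_maps_to (g := Finset.card) (t := Finset.range (n + 1))
    (fun S hS => Finset.mem_range.2 (Nat.lt_succ_of_le (by
      simpa using Finset.card_le_card (Finset.mem_powerset.1 (Finset.mem_filter.1 hS).1))))]
  refine Finset.sum_congr rfl fun k _ => ?_
  rw [positroidSeries_eq_mk, ← sum_initialSets_eq_coeff, Finset.mul_sum]
  refine Finset.sum_congr ?_ fun S hS => ?_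
  · ext S
    simp only [Finset.mem_filter, Finset.mem_powerset, mem_initialSets]
    constructor
    · rintro ⟨⟨h1, h2⟩, h3⟩
      exact ⟨h1, fun e _ => ⟨0, h2, Nat.zero_le e⟩, h3⟩
    · rintro ⟨h1, h2, h3⟩
      obtain ⟨t, ht, ht0⟩ := h2 0 hn
      exact ⟨⟨h1, Nat.le_zero.1 ht0 ▸ ht⟩, h3⟩
  · obtain ⟨hSn, hi, rfl⟩ := mem_initialSets.1 hS
    obtain ⟨t, ht, -⟩ := hi 0 hn
    rw [numWithComp_eq hSn (fun e he => hi e (Finset.mem_range.1 he)) ⟨t, ht⟩]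
    push_cast
    rfl

theorem hasSubst_X_mul (P : PowerSeries ℚ) : PowerSeries.HasSubst (PowerSeries.X * P) :=
  PowerSeries.HasSubst.of_constantCoeff_zero' (by simp)

theorem coeff_X_mul_pow_of_lt (P : PowerSeries ℚ) {n k : ℕ} (h : n < k) :
    PowerSeries.coeff n ((PowerSeries.X * P) ^ k) = 0 := by
  rw [mul_pow, PowerSeries.coeff_X_pow_mul', if_neg (not_le.2 h)]

/-- The functional equation `P(x) = P_c(x P(x))`. -/
theorem positroidSeries_eq_subst :
    positroidSeries = connectedPositroidSeries.subst (PowerSeries.X * positroidSeries) := by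
  ext n
  rw [PowerSeries.coeff_subst' (hasSubst_X_mul _),
    finsum_eq_sum_of_support_subset (s := Finset.range (n + 1)) _ (by
      intro k hk
      by_contra hkn
      rw [Finset.mem_coe, Finset.mem_range, not_lt] at hkn
      refine hk ?_
      simp only [coeff_X_mul_pow_of_lt _ hkn, smul_zero])]
  rcases Nat.eq_zero_or_pos n with rfl | hn
  · simp [positroidSeries, connectedPositroidSeries]
  · rw [positroidSeries_eq_mk, PowerSeries.coeff_mk, numPositroids_eq_sum_coeff hn,
      ← positroidSeries_eq_mk]
    refine Finset.sum_congr rfl fun k _ => ?_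
    rcases Nat.eq_zero_or_pos k with rfl | hk
    · simp [PowerSeries.coeff_one, hn.ne']
    · simp [connectedPositroidSeries, hk.ne']

theorem positroidSeries_ne_zero : positroidSeries ≠ 0 := fun h => by
  have := congrArg (PowerSeries.coeff 0) h
  simp [positroidSeries] at this

theorem xDivConnectedPositroidSeries_subst :
    xDivConnectedPositroidSeries.subst (PowerSeries.X * positroidSeries) =
      (PowerSeries.X : PowerSeries ℚ) := by
  have hG := hasSubst_X_mul positroidSeries
  have hmul : xDivConnectedPositroidSeries * connectedPositroidSeries = PowerSeries.X := by
    rw [xDivConnectedPositroidSeries, mul_assoc, PowerSeries.inv_mul_cancel _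
      (by rw [constantCoeff_connectedPositroidSeries]; exact one_ne_zero), mul_one]
  have h := congrArg (PowerSeries.subst (PowerSeries.X * positroidSeries)) hmul
  rw [PowerSeries.subst_mul hG, ← positroidSeries_eq_subst, PowerSeries.subst_X hG] at h
  exact mul_right_cancel₀ positroidSeries_ne_zero h

end PositroidEnum

/-- `x P(x)` is the compositional inverse of `x / P_c(x)`. -/
theorem mainTheorem9 :
    PowerSeries.X * PositroidEnum.positroidSeries =
      PowerSeries.substInvOfIsUnit PositroidEnum.xDivConnectedPositroidSeries
        PositroidEnum.isUnit_coeff_one_xDivConnectedPositroidSeries := by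
  set F := PositroidEnum.xDivConnectedPositroidSeries with hF
  set I := PowerSeries.substInvOfIsUnit F
    PositroidEnum.isUnit_coeff_one_xDivConnectedPositroidSeries
  have hF0 : PowerSeries.constantCoeff F = 0 := by
    simp [hF, PositroidEnum.xDivConnectedPositroidSeries]
  have hG := PositroidEnum.hasSubst_X_mul PositroidEnum.positroidSeries
  have h1 : I.subst F = PowerSeries.X := PowerSeries.subst_substInvOfIsUnit_left F hF0 _
  -- substitute `x P(x)` into the identity `I (F (x)) = x`
  have h2 := PowerSeries.subst_comp_subst_apply
    (PowerSeries.HasSubst.of_constantCoeff_zero' hF0) hG I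
  rw [h1, PowerSeries.subst_X hG, hF, PositroidEnum.xDivConnectedPositroidSeries_subst,
    PowerSeries.X_subst] at h2
  exact h2
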